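/- \textbf{Setting.} Let $X$ be an infinite set and let $b:X\times X\to[0,\infty)$ be a graph over $X$: $b$ is symmetric, has zero diagonal, and $\sum_{y\in X}b(x,y)<\infty$ for all $x\in X$. Assume that $b$ is connected, i.e. any two vertices are joined by a finite path $x_0,\dots,x_n$ with $b(x_i,x_{i+1})>0$. Let $q:X\to\mathbb R$ and $m:X\to(0,\infty)$. Let $F(X)$ be the set of $f:X\to\mathbb R$ with $\sum_{y}b(x,y)|f(y)|<\infty$ for all $x$, and for $f\in F(X)$ put $$Lf(x)=\sum_{y\in X}b(x,y)(f(x)-f(y)),\qquad H f=Lf+qf .$$ Let $C_c(X)$ be the space of finitely supported real functions on $X$, and assume that the form $$h(\varphi,\psi)=\tfrac12\sum_{x,y\in X}b(x,y)(\varphi(x)-\varphi(y))(\psi(x)-\psi(y))+\sum_{x\in X}q(x)\varphi(x)\psi(x),\qquad \varphi,\psi\in C_c(X),$$ satisfies $h(\varphi,\varphi)\ge0$ for all $\varphi\in C_c(X)$. Let $h^{(m)}$ be the closure of $h$ in the real Hilbert space $\ell^2(X,m)$ (with scalar product $\langle f,g\rangle_m=\sum_x f(x)g(x)m(x)$), and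 let $H^{(m)}$ be the associated selfadjoint operator: $f\in D(H^{(m)})$ and $H^{(m)}f=g$ mean that $f\in D(h^{(m)})$, $g\in\ell^2(X,m)$ and $h^{(m)}(f,k)=\langle g,k\rangle_m$ for all $k\in D(h^{(m)})$. Let $\lambda_0(H^{(m)})$ and $\lambda_0^{\mathrm{ess}}(H^{(m)})$ be the infima of the spectrum and of the essential spectrum of $H^{(m)}$, where the essential spectrum is the spectrum without the isolated eigenvalues of finite multiplicity; suprema and infima are taken in $[-\infty,\infty]$, so $\lambda_0^{\mathrm{ess}}(H^{(m)})=+\infty$ if the essential spectrum is empty. \textbf{Theorem (Allegretto--Piepenbrink-type theorem).} Let $S$ be the set of $\lambda\in\mathbb R$ for which there is $u\in F(X)$ with $u\ge0$, $u\ne0$ and $(H-\lambda m)u\ge0$ on $X$. (a) $\lambda_0(H^{(m)})\ge\sup S$. (b) If $D(H^{(m)})\subseteq F(X)$, then $\lambda_0(H^{(m)})=\max S$; in particular the maximum is attained. (c) If $\frac1m L\varphi\in\ell^2(X,m)$ for all $\varphi\in C_c(X)$, then $\lambda_0^{\mathrm{ess}}(H^{(m)})$ is the supremum of all $\lambda\in\mathbb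 R$ for which there are a finite set $K\subset X$ and a function $u\in F(X)$ with $u\ge0$ on $X$, $u>0$ on $X\setminus K$ and $(H-\lambda m)u\ge0$ on $X\setminus K$. -/

import Mathlib

open Filter Topology

noncomputable section

/-- `f ∈ ℓ²(X, m)`: `f` is square summable with respect to the weight `m`. -/
def MemL2 {X : Type*} (m f : X → ℝ) : Prop :=
  Summable fun x => f x ^ 2 * m x

/-- The scalar product `⟨f, g⟩_m` of `ℓ²(X, m)`. -/
def l2Inner {X : Type*} (m f g : X → ℝ) : ℝ :=
  ∑' x, f x * g x * m x

/-- The norm of `ℓ²(X, m)`. -/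
def l2Norm {X : Type*} (m f : X → ℝ) : ℝ :=
  Real.sqrt (l2Inner m f f)

/-- A linear operator `A` in `ℓ²(X, m)`, not necessarily everywhere defined, is represented by its
graph `A = {(f, g) | f ∈ D(A), g = A f}`.  This is its domain. -/
def opDomain {X : Type*} (A : Set ((X → ℝ) × (X → ℝ))) : Set (X → ℝ) :=
  {f | ∃ g, (f, g) ∈ A}

/-- The resolvent set of an operator in `ℓ²(X, m)` with graph `A`: the real `t` such that
`A - t : D(A) → ℓ²(X, m)` is bijective with bounded inverse. -/
def resolventSetL2 {X : Type*} (m : X → ℝ) (A : Set ((X → ℝ) × (X → ℝ))) : Set ℝ :=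
  {t | (∀ k, MemL2 m k → ∃! f, (f, k + t • f) ∈ A) ∧
    ∃ C : ℝ, ∀ f g, (f, g) ∈ A → l2Norm m f ≤ C * l2Norm m (g - t • f)}

/-- The spectrum of an operator with graph `A` (all operators considered are selfadjoint, so that
the spectrum is real). -/
def spectrumL2 {X : Type*} (m : X → ℝ) (A : Set ((X → ℝ) × (X → ℝ))) : Set ℝ :=
  (resolventSetL2 m A)ᶜ

/-- The set of eigenfunctions for `t`, together with `0`. -/
def eigenspaceL2 {X : Type*} (A : Set ((X → ℝ) × (X → ℝ))) (t : ℝ) : Set (X → ℝ) :=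
  {f | (f, t • f) ∈ A}

/-- The discrete spectrum: the isolated points of the spectrum that are eigenvalues of finite
multiplicity. -/
def discreteSpectrumL2 {X : Type*} (m : X → ℝ) (A : Set ((X → ℝ) × (X → ℝ))) : Set ℝ :=
  {t | t ∈ spectrumL2 m A ∧
    (∃ ε : ℝ, 0 < ε ∧ ∀ s ∈ spectrumL2 m A, |s - t| < ε → s = t) ∧
    (∃ f ∈ eigenspaceL2 A t, f ≠ 0) ∧
    FiniteDimensional ℝ (Submodule.span ℝ (eigenspaceL2 A t))}

/-- The essential spectrum of a selfadjoint operator with graph `A`. -/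
def essSpectrumL2 {X : Type*} (m : X → ℝ) (A : Set ((X → ℝ) × (X → ℝ))) : Set ℝ :=
  spectrumL2 m A \ discreteSpectrumL2 m A

/-- The bottom of the spectrum, in the extended real line. -/
def spectrumBottom {X : Type*} (m : X → ℝ) (A : Set ((X → ℝ) × (X → ℝ))) : EReal :=
  sInf ((fun t : ℝ => (t : EReal)) '' spectrumL2 m A)

/-- The bottom of the essential spectrum, in the extended real line; it is `⊤` if the essential
spectrum is empty. -/
def essSpectrumBottom {X : Type*} (m : X → ℝ) (A : Set ((X → ℝ) × (X → ℝ))) : EReal :=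
  sInf ((fun t : ℝ => (t : EReal)) '' essSpectrumL2 m A)

/-- A graph over `X`: a symmetric, locally summable edge weight `b : X × X → [0, ∞)` with zero
diagonal. -/
structure SummableGraph (X : Type*) where
  b : X → X → ℝ
  nonneg : ∀ x y, 0 ≤ b x y
  symm : ∀ x y, b x y = b y x
  diag : ∀ x, b x x = 0
  locallySummable : ∀ x, Summable fun y => b x y

namespace SummableGraph

/-- Any two vertices are joined by a finite path along edges of positive weight. -/
def Connected {X : Type*} (G : SummableGraph X) : Prop :=
  ∀ x y, Relation.ReflTransGen (fun u v => 0 < G.b u v) x y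

/-- The space `F(X)` on which the formal Laplacian acts. -/
def formalDomain {X : Type*} (G : SummableGraph X) : Set (X → ℝ) :=
  {f | ∀ x, Summable fun y => G.b x y * |f y|}

/-- The formal Laplacian `L`. -/
def laplacian {X : Type*} (G : SummableGraph X) (f : X → ℝ) (x : X) : ℝ :=
  ∑' y, G.b x y * (f x - f y)

/-- The formal Schrödinger operator `H = L + q`. -/
def schrodinger {X : Type*} (G : SummableGraph X) (q f : X → ℝ) (x : X) : ℝ :=
  G.laplacian f x + q x * f x

/-- The bilinear form `h` on finitely supported functions. -/
def form {X : Type*} (G : SummableGraph X) (q : X → ℝ) (φ ψ : X →₀ ℝ) : ℝ :=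
  1 / 2 * ∑' p : X × X, G.b p.1 p.2 * (φ p.1 - φ p.2) * (ψ p.1 - ψ p.2) +
    ∑' x, q x * φ x * ψ x

/-- The sequence `φ` in `C_c(X)` is Cauchy with respect to `h` and converges to `f` in
`ℓ²(X, m)`. -/
def Approximates {X : Type*} (G : SummableGraph X) (q m : X → ℝ) (φ : ℕ → X →₀ ℝ)
    (f : X → ℝ) : Prop :=
  Tendsto (fun n => l2Norm m (⇑(φ n) - f)) atTop (𝓝 0) ∧
    Tendsto (fun p : ℕ × ℕ => G.form q (φ p.1 - φ p.2) (φ p.1 - φ p.2)) atTop (𝓝 0)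

/-- The domain `D(h^{(m)})` of the closure of `h` in `ℓ²(X, m)`. -/
def closureDomain {X : Type*} (G : SummableGraph X) (q m : X → ℝ) : Set (X → ℝ) :=
  {f | MemL2 m f ∧ ∃ φ, G.Approximates q m φ f}

/-- For `f, k ∈ D(h^{(m)})`: the closure of `h` takes the value `c` at `(f, k)`, that is
`h(φₙ, ψₙ) → c` for all approximating sequences `φₙ` of `f` and `ψₙ` of `k`. -/
def ClosureValue {X : Type*} (G : SummableGraph X) (q m f k : X → ℝ) (c : ℝ) : Prop :=
  ∀ φ ψ, G.Approximates q m φ f → G.Approximates q m ψ k →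
    Tendsto (fun n => G.form q (φ n) (ψ n)) atTop (𝓝 c)

/-- The graph of the operator `H^{(m)}` in `ℓ²(X, m)` associated with the closure `h^{(m)}`:
`f ∈ D(h^{(m)})` and `h^{(m)}(f, k) = ⟨g, k⟩_m` for all `k ∈ D(h^{(m)})`. -/
def operator {X : Type*} (G : SummableGraph X) (q m : X → ℝ) : Set ((X → ℝ) × (X → ℝ)) :=
  {p | p.1 ∈ G.closureDomain q m ∧ MemL2 m p.2 ∧
    ∀ k ∈ G.closureDomain q m, G.ClosureValue q m p.1 k (l2Inner m p.2 k)}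

/-- `u` is a nonnegative function in `F(X)` with `H u ≥ 0` on `W`. -/
def IsNonnegSuperharmonicOn {X : Type*} (G : SummableGraph X) (q : X → ℝ) (W : Set X)
    (u : X → ℝ) : Prop :=
  u ∈ G.formalDomain ∧ (∀ x, 0 ≤ u x) ∧ ∀ x ∈ W, 0 ≤ G.schrodinger q u x

/-- The real `t` such that `H - t m` has a positive (that is nonnegative and nonzero)
superharmonic function on `X`. -/
def positiveLevels {X : Type*} (G : SummableGraph X) (q m : X → ℝ) : Set ℝ :=
  {t | ∃ u, G.IsNonnegSuperharmonicOn (q - t • m) Set.univ u ∧ u ≠ 0}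

/-- The real `t` such that, for some finite `K`, there is a nonnegative function that is
`(H - t m)`-superharmonic and strictly positive on `X \ K`. -/
def positiveLevelsAtInfinity {X : Type*} (G : SummableGraph X) (q m : X → ℝ) : Set ℝ :=
  {t | ∃ K : Finset X, ∃ u, G.IsNonnegSuperharmonicOn (q - t • m) (↑K)ᶜ u ∧ ∀ x ∉ K, 0 < u x}

end SummableGraph

end

/-! Everything rests on one equivalence (`mem_positiveLevels_iff`): `t` admits a positive
superharmonic function iff `h - t⟨·,·⟩_m ≥ 0` on `C_c(X)`. Given `u > 0` superharmonic, the ground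
state transform writes the form as a weighted gradient energy of `φ/u` plus a nonnegative potential
term. Conversely, a nonnegative form yields Green's functions of finite sets, normalised at a point;
a Harnack bound gives pointwise limits, and a Fatou argument keeps superharmonicity even though
vertices may have infinitely many neighbours.

The same transform shows `h = ‖a φ‖²` for a closable map `a` (`exists_gradient`). Hence the form
domain embeds injectively in `ℓ²` by some `ι`, and `(H + 1)⁻¹` is the bounded operator `R = ι ι*`
(`exists_resolvent`). A spectral value `t` of `H` corresponds to `s = 1/(1+t)` for `R`, so all
spectral theory takes place for a bounded symmetric operator and is done by quadratic estimates
instead of a functional calculus.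

Lower bounds on `h` become upper bounds on `R` and conversely. If `h ≥ t`, then `R ≤ 1/(1+t)` and
there is no spectrum below `t`; if the spectrum lies above `t`, Cauchy-Schwarz in the form space
returns `h ≥ t`. With closedness of the set of levels this settles the bottom of the spectrum.

For the essential spectrum, a level at infinity gives `h ≥ t` on functions vanishing on a finite
`K`, so `R ≤ 1/(1+t)` on a subspace of finite codimension, and the spectrum below `t` is discrete.
Conversely, if the spectrum up to `t` is discrete, `h ≥ t` holds up to a finite rank projection. For
`c < t`, that projection is dominated by a potential supported on a finite set plus a small multiple
of the norm. Adding this potential makes `h - c` nonnegative, and a positive superharmonic function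
of the perturbed operator serves outside the finite set. -/

/-! ### Spectral estimates for bounded symmetric operators -/

section BoundedSymmetric

open scoped InnerProductSpace

variable {E : Type*} [NormedAddCommGroup E] [InnerProductSpace ℝ E]

/-- Cauchy-Schwarz for the form of a symmetric operator that is nonnegative on an invariant
subspace. -/
theorem norm_sq_le_of_inner_nonneg_on (T : E →L[ℝ] E) (hT : ∀ x y, ⟪T x, y⟫_ℝ = ⟪x, T y⟫_ℝ)
    (W : Submodule ℝ E) (hW : ∀ x ∈ W, T x ∈ W) (h : ∀ x ∈ W, 0 ≤ ⟪T x, x⟫_ℝ)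
    {x : E} (hx : x ∈ W) : ‖T x‖ ^ 2 ≤ ‖T‖ * ⟪T x, x⟫_ℝ := by
  rcases eq_or_ne ‖T‖ 0 with h0 | h0
  · have : T = 0 := norm_eq_zero.1 h0
    simp [this]
  have hp : 0 < ‖T‖ := lt_of_le_of_ne (norm_nonneg _) (Ne.symm h0)
  -- The step length `1/‖T‖` balances the cross term against the bound `‖T‖ ‖T x‖²` for the
  -- quadratic term.
  have h1 := h (x + (-1 / ‖T‖) • T x) (W.add_mem hx (W.smul_mem _ (hW x hx)))
  have h2 : ⟪T (T x), T x⟫_ℝ ≤ ‖T‖ * ‖T x‖ ^ 2 := by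
    calc ⟪T (T x), T x⟫_ℝ ≤ ‖T (T x)‖ * ‖T x‖ := real_inner_le_norm _ _
      _ ≤ (‖T‖ * ‖T x‖) * ‖T x‖ := by gcongr; exact T.le_opNorm _
      _ = _ := by ring
  have h3 : ⟪T (T x), x⟫_ℝ = ‖T x‖ ^ 2 := by rw [hT, real_inner_self_eq_norm_sq]
  have h4 : ⟪T x, T x⟫_ℝ = ‖T x‖ ^ 2 := real_inner_self_eq_norm_sq _
  simp only [map_add, map_smul, inner_add_left, inner_add_right, real_inner_smul_left,
    real_inner_smul_right, h3, h4] at h1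
  have h5 : (-1 / ‖T‖) * ((-1 / ‖T‖) * ⟪T (T x), T x⟫_ℝ) ≤ ‖T x‖ ^ 2 / ‖T‖ := by
    have : (-1 / ‖T‖) * ((-1 / ‖T‖) * ⟪T (T x), T x⟫_ℝ) = ⟪T (T x), T x⟫_ℝ / ‖T‖ ^ 2 := by
      field_simp
    rw [this, div_le_div_iff₀ (by positivity) hp]
    nlinarith
  have h6 : -1 / ‖T‖ * ‖T x‖ ^ 2 = - (‖T x‖ ^ 2 / ‖T‖) := by ring
  have h7 : ‖T x‖ ^ 2 / ‖T‖ ≤ ⟪T x, x⟫_ℝ := by linarith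
  rw [div_le_iff₀ hp] at h7
  linarith

/-- If all positive shifts of a symmetric operator are bounded below on an invariant subspace, then
its form is nonnegative there. -/
theorem inner_nonneg_on_of_shifts_bounded_below (T : E →L[ℝ] E)
    (hT : ∀ x y, ⟪T x, y⟫_ℝ = ⟪x, T y⟫_ℝ) (W : Submodule ℝ E) (hW : ∀ x ∈ W, T x ∈ W)
    (h : ∀ κ : ℝ, 0 < κ → ∃ c : ℝ, 0 < c ∧ ∀ x ∈ W, c * ‖x‖ ≤ ‖T x + κ • x‖)
    {x : E} (hx : x ∈ W) : 0 ≤ ⟪T x, x⟫_ℝ := by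
  -- Take the least shift `ν` that makes the form nonnegative on `W`. If `ν > 0`, then `T + ν` is
  -- nonnegative and bounded below there, hence coercive by the previous lemma, and `ν` could be
  -- lowered.
  set S : Set ℝ := {κ | 0 ≤ κ ∧ ∀ x ∈ W, 0 ≤ ⟪T x, x⟫_ℝ + κ * ‖x‖ ^ 2} with hS
  have hne : ‖T‖ ∈ S := by
    refine ⟨norm_nonneg _, fun x _ => ?_⟩
    have h1 := abs_le.1 (abs_real_inner_le_norm (T x) x)
    have h2 : ‖T x‖ * ‖x‖ ≤ ‖T‖ * ‖x‖ * ‖x‖ := by gcongr; exact T.le_opNorm _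
    nlinarith
  have hbdd : BddBelow S := ⟨0, fun κ hκ => hκ.1⟩
  have hclosed : IsClosed S := by
    have : S = Set.Ici 0 ∩ ⋂ x ∈ W, {κ : ℝ | 0 ≤ ⟪T x, x⟫_ℝ + κ * ‖x‖ ^ 2} := by
      ext κ; simp [hS]
    rw [this]
    refine isClosed_Ici.inter (isClosed_biInter fun x _ => ?_)
    exact isClosed_le continuous_const (by fun_prop)
  have hν : sInf S ∈ S := hclosed.csInf_mem ⟨_, hne⟩ hbdd
  set ν := sInf S
  rcases hν.1.eq_or_lt with h0 | h0
  · simpa [← h0] using hν.2 x hx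
  exfalso
  obtain ⟨c, hc, hcx⟩ := h ν h0
  set T' : E →L[ℝ] E := T + ν • ContinuousLinearMap.id ℝ E with hT'
  have hT'x : ∀ x, T' x = T x + ν • x := fun x => by simp [hT']
  have hinner : ∀ x, ⟪T' x, x⟫_ℝ = ⟪T x, x⟫_ℝ + ν * ‖x‖ ^ 2 := fun x => by
    rw [hT'x, inner_add_left, real_inner_smul_left, real_inner_self_eq_norm_sq]
  have key := fun x (hx : x ∈ W) => norm_sq_le_of_inner_nonneg_on T'
    (fun x y => by simp [hT'x, inner_add_left, inner_add_right, real_inner_smul_left,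
      real_inner_smul_right, hT])
    W (fun x hx => by rw [hT'x]; exact W.add_mem (hW x hx) (W.smul_mem _ hx))
    (fun x hx => by rw [hinner]; exact hν.2 x hx) hx
  set d := c ^ 2 / (‖T'‖ + 1) with hd
  have hd0 : 0 < d := by positivity
  have hlow : ∀ x ∈ W, d * ‖x‖ ^ 2 ≤ ⟪T x, x⟫_ℝ + ν * ‖x‖ ^ 2 := by
    intro x hx
    have h1 := key x hx
    have h2 := hcx x hx
    rw [← hT'x] at h2
    have h3 : (c * ‖x‖) ^ 2 ≤ ‖T' x‖ ^ 2 := by gcongr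
    have h4 := hν.2 x hx
    rw [← hinner] at h4 ⊢
    rw [hd, div_mul_eq_mul_div, div_le_iff₀ (by positivity)]
    nlinarith
  have hmem : max 0 (ν - d) ∈ S := by
    refine ⟨le_max_left _ _, fun x hx => ?_⟩
    have h1 := hlow x hx
    have h2 : (ν - d) * ‖x‖ ^ 2 ≤ max 0 (ν - d) * ‖x‖ ^ 2 := by
      gcongr; exact le_max_right _ _
    linarith
  have := csInf_le hbdd hmem
  have h5 : max 0 (ν - d) < ν := max_lt h0 (by linarith)
  exact absurd this (not_le.2 h5)

theorem exists_bounded_below_of_isUnit {T : E →L[ℝ] E} (hT : IsUnit T) :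
    ∃ c : ℝ, 0 < c ∧ ∀ x, c * ‖x‖ ≤ ‖T x‖ := by
  obtain ⟨⟨T, S, -, hST⟩, rfl⟩ := hT
  refine ⟨1 / (‖S‖ + 1), by positivity, fun x => ?_⟩
  have h1 : S (T x) = x := by
    have := congrArg (fun A : E →L[ℝ] E => A x) hST
    simpa using this
  have h2 := S.le_opNorm (T x)
  rw [h1] at h2
  rw [one_div, inv_mul_le_iff₀ (by positivity)]
  have := norm_nonneg (T x)
  show ‖x‖ ≤ (‖S‖ + 1) * ‖T x‖
  nlinarith

theorem isUnit_of_bijective [CompleteSpace E] {T : E →L[ℝ] E} (hT : Function.Bijective T) :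
    IsUnit T :=
  ContinuousLinearMap.isUnit_iff_bijective.2 hT

theorem bijective_of_isUnit {T : E →L[ℝ] E} (hT : IsUnit T) : Function.Bijective T := by
  obtain ⟨⟨T, S, hTS, hST⟩, rfl⟩ := hT
  refine Function.bijective_iff_has_inverse.2 ⟨S, fun x => ?_, fun x => ?_⟩
  · simpa using congrArg (fun A : E →L[ℝ] E => A x) hST
  · simpa using congrArg (fun A : E →L[ℝ] E => A x) hTS

/-- If `0` is at most an isolated point of the spectrum of a symmetric operator, then the operator
is bounded below on the orthogonal complement of its kernel. -/
theorem exists_bounded_below_of_isolated [CompleteSpace E] (T : E →L[ℝ] E)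
    (hT : ∀ x y, ⟪T x, y⟫_ℝ = ⟪x, T y⟫_ℝ) {ε : ℝ} (hε : 0 < ε)
    (h : ∀ μ : ℝ, μ ≠ 0 → |μ| < ε → IsUnit (T + algebraMap ℝ (E →L[ℝ] E) μ)) :
    ∃ c : ℝ, 0 < c ∧ ∀ x ∈ (LinearMap.ker (T : E →ₗ[ℝ] E))ᗮ, c * ‖x‖ ≤ ‖T x‖ := by
  set c := ε ^ 2 with hc
  have hc0 : 0 < c := by positivity
  have hfac : ∀ r : ℝ, 0 < r → r < c → IsUnit (T * T - algebraMap ℝ (E →L[ℝ] E) r) := by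
    intro r hr hrc
    have hs : 0 < √r := Real.sqrt_pos.2 hr
    have hs' : √r < ε := (Real.sqrt_lt' hε).2 hrc
    have h1 := h (√r) hs.ne' (by rwa [abs_of_pos hs])
    have h2 := h (-√r) (by simpa using hs.ne') (by rwa [abs_neg, abs_of_pos hs])
    have h3 : T * T - algebraMap ℝ (E →L[ℝ] E) r =
        (T + algebraMap ℝ (E →L[ℝ] E) (√r)) * (T + algebraMap ℝ (E →L[ℝ] E) (-√r)) := by
      ext x
      simp only [Algebra.algebraMap_eq_smul_one]
      simp [smul_smul, Real.mul_self_sqrt hr.le]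
      abel
    rw [h3]; exact h1.mul h2
  -- `y² - c y` is nonnegative at `y = s²` for `s = 0` and for `|s| ≥ ε`, so `G` should be
  -- nonnegative. For `κ > 0` the polynomial `y² - c y + κ` either has both roots in `(0, c)`, where
  -- `T² - r` is invertible, or is bounded below by `κ - c²/4 > 0`.
  set G : E →L[ℝ] E := T * T * (T * T) - c • (T * T) with hG
  have hGx : ∀ x, G x = T (T (T (T x))) - c • T (T x) := fun x => by simp [hG]
  have hGnonneg : ∀ x, 0 ≤ ⟪G x, x⟫_ℝ := by
    intro x
    refine inner_nonneg_on_of_shifts_bounded_below G (fun x y => ?_) ⊤ (by simp) ?_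
      (Submodule.mem_top (x := x))
    · simp [hGx, inner_sub_left, inner_sub_right, real_inner_smul_left, real_inner_smul_right, hT]
    intro κ hκ
    rcases le_or_gt 0 (c ^ 2 - 4 * κ) with hd | hd
    · set s := √(c ^ 2 - 4 * κ) with hs
      have hs0 : 0 ≤ s := Real.sqrt_nonneg _
      have hsq : s * s = c ^ 2 - 4 * κ := Real.mul_self_sqrt hd
      have hsc : s < c := by nlinarith
      have hu := (hfac ((c + s) / 2) (by linarith) (by linarith)).mul
        (hfac ((c - s) / 2) (by linarith) (by linarith))
      obtain ⟨d, hd, hdx⟩ := exists_bounded_below_of_isUnit hu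
      refine ⟨d, hd, fun x _ => (hdx x).trans_eq ?_⟩
      congr 1
      have hk : κ = (c + s) / 2 * ((c - s) / 2) := by nlinarith
      rw [hGx, hk]
      simp only [Algebra.algebraMap_eq_smul_one]
      simp
      module
    · refine ⟨κ - c ^ 2 / 4, by linarith, fun x _ => ?_⟩
      rcases eq_or_ne x 0 with rfl | hx
      · simp
      have hx0 : 0 < ‖x‖ := norm_pos_iff.2 hx
      have h1 : (κ - c ^ 2 / 4) * ‖x‖ ^ 2 ≤ ⟪G x + κ • x, x⟫_ℝ := by
        have h2 : ⟪G x + κ • x, x⟫_ℝ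
            = ‖T (T x) - (c / 2) • x‖ ^ 2 + (κ - c ^ 2 / 4) * ‖x‖ ^ 2 := by
          rw [← real_inner_self_eq_norm_sq (T (T x) - (c / 2) • x)]
          simp only [hGx, inner_add_left, inner_sub_left, inner_sub_right, real_inner_smul_left,
            real_inner_smul_right, real_inner_self_eq_norm_sq x, ← hT, map_sub, map_smul]
          ring
        rw [h2]; nlinarith [sq_nonneg ‖T (T x) - (c / 2) • x‖]
      have h3 := h1.trans (real_inner_le_norm _ _)
      have h4 : (κ - c ^ 2 / 4) * ‖x‖ * ‖x‖ ≤ ‖G x + κ • x‖ * ‖x‖ := by nlinarith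
      exact le_of_mul_le_mul_right h4 hx0
  have hrange : ∀ x, ε * ‖T x‖ ≤ ‖T (T x)‖ := by
    intro x
    have h1 := hGnonneg x
    have h2 : ⟪G x, x⟫_ℝ = ‖T (T x)‖ ^ 2 - c * ‖T x‖ ^ 2 := by
      rw [← real_inner_self_eq_norm_sq, ← real_inner_self_eq_norm_sq]
      simp only [hGx, inner_sub_left, real_inner_smul_left, hT]
    rw [h2] at h1
    refine le_of_sq_le_sq ?_ (norm_nonneg _)
    rw [mul_pow]; linarith
  refine ⟨ε, hε, fun x hx => ?_⟩
  -- The bound is known on the range; by self-adjointness the closure of the range is the orthogonal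
  -- complement of the kernel.
  have hadj : ContinuousLinearMap.adjoint T = T :=
    ContinuousLinearMap.ext fun x => ext_inner_right ℝ fun y => by
      rw [ContinuousLinearMap.adjoint_inner_left, hT]
  have hcl : x ∈ closure (Set.range T) := by
    have h1 := ContinuousLinearMap.orthogonal_ker T
    rw [hadj] at h1
    have h2 : x ∈ (LinearMap.range (T : E →ₗ[ℝ] E)).topologicalClosure := by
      rw [← h1]; exact hx
    exact h2
  have hset : IsClosed {y : E | ε * ‖y‖ ≤ ‖T y‖} := isClosed_le (by fun_prop) (by fun_prop)
  exact (hset.closure_subset_iff.2 (by rintro _ ⟨z, rfl⟩; exact hrange z)) hcl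

/-- A symmetric operator that is coercive on a subspace of finite codimension and injective is
invertible. -/
theorem isUnit_of_coercive_of_ker_eq_bot [CompleteSpace E] (T : E →L[ℝ] E)
    (hT : ∀ x y, ⟪T x, y⟫_ℝ = ⟪x, T y⟫_ℝ) (N : Submodule ℝ E) [FiniteDimensional ℝ N] {δ : ℝ}
    (hδ : 0 < δ) (h : ∀ x ∈ Nᗮ, δ * ‖x‖ ^ 2 ≤ ⟪T x, x⟫_ℝ) (hker : ∀ x, T x = 0 → x = 0) :
    IsUnit T := by
  refine isUnit_of_bijective ⟨(injective_iff_map_eq_zero T).2 hker, ?_⟩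
  set P : Submodule ℝ E := Nᗮ.map (T : E →ₗ[ℝ] E) with hP
  have hbelow : ∀ x ∈ Nᗮ, δ * ‖x‖ ≤ ‖T x‖ := by
    intro x hx
    rcases eq_or_ne x 0 with rfl | hx0
    · simp
    have h1 := (h x hx).trans (real_inner_le_norm _ _)
    have h2 : δ * ‖x‖ * ‖x‖ ≤ ‖T x‖ * ‖x‖ := by nlinarith
    exact le_of_mul_le_mul_right h2 (norm_pos_iff.2 hx0)
  have hPcl : IsClosed (P : Set E) := by
    have hanti : AntilipschitzWith (Real.toNNReal δ⁻¹) (T ∘L Nᗮ.subtypeL) := by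
      refine ContinuousLinearMap.antilipschitz_of_bound _ fun x => ?_
      rw [Real.coe_toNNReal _ (by positivity), ← div_eq_inv_mul, le_div_iff₀ hδ, mul_comm]
      exact hbelow x x.2
    have h1 := hanti.isClosed_range (T ∘L Nᗮ.subtypeL).uniformContinuous
    convert h1 using 1
    ext y
    simp [hP]
  have hcl := Submodule.isClosed_sup_finiteDimensional P (N.map (T : E →ₗ[ℝ] E)) hPcl
  -- The range is a closed space plus a finite-dimensional one, hence closed; symmetry and the
  -- trivial kernel make it dense.
  have hsup : N.map (T : E →ₗ[ℝ] E) ⊔ P = LinearMap.range (T : E →ₗ[ℝ] E) := by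
    rw [hP, ← Submodule.map_sup, Submodule.sup_orthogonal_of_hasOrthogonalProjection,
      Submodule.map_top]
  have hcl' : IsClosed (LinearMap.range (T : E →ₗ[ℝ] E) : Set E) := by
    rw [← hsup, sup_comm]
    exact hcl
  have hbot : (LinearMap.range (T : E →ₗ[ℝ] E))ᗮ = ⊥ := by
    rw [Submodule.eq_bot_iff]
    intro x hx
    refine hker x (ext_inner_right ℝ fun y => ?_)
    rw [hT, inner_zero_left, real_inner_comm]
    exact (Submodule.mem_orthogonal _ _).1 hx _ ⟨y, rfl⟩
  have := hcl'.completeSpace_coe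
  have htop := (Submodule.orthogonal_eq_bot_iff (K := LinearMap.range (T : E →ₗ[ℝ] E))).1 hbot
  intro y
  have hy : y ∈ LinearMap.range (T : E →ₗ[ℝ] E) := htop ▸ Submodule.mem_top
  exact hy

/-- If `R ≤ r` on a subspace of finite codimension, then the values above `r` where `R - s` has a
nontrivial kernel are finite in number. -/
theorem finite_eigenvalues_gt (R : E →L[ℝ] E)
    (hR : ∀ x y, ⟪R x, y⟫_ℝ = ⟪x, R y⟫_ℝ) (N : Submodule ℝ E) [FiniteDimensional ℝ N] {r : ℝ}
    (h : ∀ x ∈ Nᗮ, ⟪R x, x⟫_ℝ ≤ r * ‖x‖ ^ 2) :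
    {s : ℝ | r < s ∧ ∃ x, x ≠ 0 ∧ R x = s • x}.Finite := by
  by_contra hinf
  obtain ⟨S, hS, hcard⟩ := Set.Infinite.exists_subset_card_eq hinf (Module.finrank ℝ N + 1)
  choose! e he0 he using fun s (hs : s ∈ S) => (hS hs).2
  have horth : ∀ s ∈ S, ∀ t ∈ S, s ≠ t → ⟪e s, e t⟫_ℝ = 0 := by
    intro s hs t ht hst
    have h1 := hR (e s) (e t)
    rw [he s hs, he t ht, real_inner_smul_left, real_inner_smul_right] at h1
    have h2 : (s - t) * ⟪e s, e t⟫_ℝ = 0 := by linarith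
    exact (mul_eq_zero.1 h2).resolve_left (sub_ne_zero.2 hst)
  let f : (S → ℝ) →ₗ[ℝ] E := ∑ s : S, (LinearMap.proj s).smulRight (e s)
  have hf : ∀ c, f c = ∑ s : S, c s • e s := fun c => by simp [f]
  let g : (S → ℝ) →ₗ[ℝ] N := (N.orthogonalProjectionOnto : E →ₗ[ℝ] N) ∘ₗ f
  -- With more orthogonal eigenvectors than `dim N`, some nontrivial combination lies in `Nᗮ`, where
  -- its Rayleigh quotient exceeds `r`.
  have hg : ¬ Function.Injective g := by
    intro hinj
    have := LinearMap.finrank_le_finrank_of_injective hinj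
    simp [hcard] at this
  rw [injective_iff_map_eq_zero] at hg
  push Not at hg
  obtain ⟨c, hc, hc0⟩ := hg
  have hmem : f c ∈ Nᗮ := Submodule.orthogonalProjectionOnto_eq_zero_iff.1 hc
  have hnorm : ∀ d : S → ℝ, ⟪∑ s : S, d s • e s, ∑ s : S, c s • e s⟫_ℝ
      = ∑ s : S, d s * c s * ‖e s‖ ^ 2 := by
    intro d
    rw [sum_inner]
    refine Finset.sum_congr rfl fun s _ => ?_
    rw [inner_sum, Finset.sum_eq_single s]
    · rw [real_inner_smul_left, real_inner_smul_right, real_inner_self_eq_norm_sq]; ring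
    · intro t _ hts
      rw [real_inner_smul_left, real_inner_smul_right,
        horth s s.2 t t.2 (fun h => hts (Subtype.ext h.symm))]
      simp
    · simp
  have h1 := h _ hmem
  rw [← real_inner_self_eq_norm_sq, hf, hnorm, map_sum] at h1
  have h2 : ∑ s : S, R (c s • e s) = ∑ s : S, ((s : ℝ) * c s) • e s :=
    Finset.sum_congr rfl fun s _ => by rw [map_smul, he s s.2, smul_smul, mul_comm]
  rw [h2, hnorm (fun s => (s : ℝ) * c s), Finset.mul_sum] at h1
  obtain ⟨s₀, hs₀⟩ := Function.ne_iff.1 hc0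
  refine absurd h1 (not_le.2 (Finset.sum_lt_sum (fun s _ => ?_) ⟨s₀, Finset.mem_univ _, ?_⟩))
  · have := (hS s.2).1
    have h3 : 0 ≤ c s * c s * ‖e s‖ ^ 2 := by positivity [mul_self_nonneg (c s)]
    nlinarith
  · have h4 := (hS s₀.2).1
    have h5 : 0 < ‖e s₀‖ := norm_pos_iff.2 (he0 s₀ s₀.2)
    have h6 : 0 < c s₀ * c s₀ := mul_self_pos.2 hs₀
    have h3 : 0 < c s₀ * c s₀ * ‖e s₀‖ ^ 2 := by positivity
    nlinarith

theorem finiteDimensional_ker_of_le (R : E →L[ℝ] E) (N : Submodule ℝ E) [FiniteDimensional ℝ N]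
    {r s : ℝ} (h : ∀ x ∈ Nᗮ, ⟪R x, x⟫_ℝ ≤ r * ‖x‖ ^ 2) (hrs : r < s) :
    FiniteDimensional ℝ (LinearMap.ker ((R - algebraMap ℝ (E →L[ℝ] E) s : E →L[ℝ] E) : E →ₗ[ℝ] E)) := by
  set K := LinearMap.ker ((R - algebraMap ℝ (E →L[ℝ] E) s : E →L[ℝ] E) : E →ₗ[ℝ] E)
  refine FiniteDimensional.of_injective ((N.orthogonalProjectionOnto : E →ₗ[ℝ] N) ∘ₗ K.subtype) ?_
  rw [injective_iff_map_eq_zero]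
  rintro ⟨x, hx⟩ h0
  have hmem : x ∈ Nᗮ := Submodule.orthogonalProjectionOnto_eq_zero_iff.1 h0
  have hRx : R x = s • x := by
    have : R x - s • x = 0 := by simpa [K, Algebra.algebraMap_eq_smul_one] using hx
    exact sub_eq_zero.1 this
  have h1 := h x hmem
  rw [hRx, real_inner_smul_left, real_inner_self_eq_norm_sq] at h1
  have h2 : (s - r) * ‖x‖ ^ 2 ≤ 0 := by linarith
  have h3 : ‖x‖ ^ 2 ≤ 0 := by
    by_contra h4
    nlinarith
  have h4 : ‖x‖ = 0 := by nlinarith [norm_nonneg x]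
  exact Subtype.ext (norm_eq_zero.1 h4)

/-- If `R ≤ r` on a subspace of finite codimension, then `R - s` is invertible for `s > r` unless it
has a kernel. -/
theorem isUnit_sub_of_gt [CompleteSpace E] (R : E →L[ℝ] E)
    (hR : ∀ x y, ⟪R x, y⟫_ℝ = ⟪x, R y⟫_ℝ) (N : Submodule ℝ E) [FiniteDimensional ℝ N] {r s : ℝ}
    (h : ∀ x ∈ Nᗮ, ⟪R x, x⟫_ℝ ≤ r * ‖x‖ ^ 2) (hrs : r < s) (hs : ∀ x, R x = s • x → x = 0) :
    IsUnit (R - algebraMap ℝ (E →L[ℝ] E) s) := by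
  rw [← IsUnit.neg_iff, neg_sub]
  have hx : ∀ x, (algebraMap ℝ (E →L[ℝ] E) s - R) x = s • x - R x := fun x => by
    simp [Algebra.algebraMap_eq_smul_one]
  refine isUnit_of_coercive_of_ker_eq_bot _ (fun x y => ?_) N (sub_pos.2 hrs) (fun x hxN => ?_)
    fun x h0 => hs x ?_
  · simp only [hx, inner_sub_left, inner_sub_right, real_inner_smul_left, real_inner_smul_right,
      hR]
  · rw [hx, inner_sub_left, real_inner_smul_left, real_inner_self_eq_norm_sq]
    linarith [h x hxN]
  · rw [hx] at h0
    exact (sub_eq_zero.1 h0).symm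

/-- If the part of the spectrum of `R` in `[r, ∞)` consists of isolated points, then `R ≤ r` on the
orthogonal complement of the corresponding eigenspaces. -/
theorem inner_le_of_isolated [CompleteSpace E] (R : E →L[ℝ] E)
    (hR : ∀ x y, ⟪R x, y⟫_ℝ = ⟪x, R y⟫_ℝ) {r : ℝ}
    (h : ∀ s ∈ spectrum ℝ R, r ≤ s → ∃ ε : ℝ, 0 < ε ∧ ∀ t ∈ spectrum ℝ R, |t - s| < ε → t = s)
    {x : E} (hx : ∀ s ∈ spectrum ℝ R, r ≤ s → ∀ y, R y = s • y → ⟪y, x⟫_ℝ = 0) :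
    ⟪R x, x⟫_ℝ ≤ r * ‖x‖ ^ 2 := by
  let W : Submodule ℝ E :=
    { carrier := {x | ∀ s ∈ spectrum ℝ R, r ≤ s → ∀ y, R y = s • y → ⟪y, x⟫_ℝ = 0}
      add_mem' := fun ha hb s hs hrs y hy => by
        rw [inner_add_right, ha s hs hrs y hy, hb s hs hrs y hy, add_zero]
      zero_mem' := fun s _ _ y _ => inner_zero_right _
      smul_mem' := fun c a ha s hs hrs y hy => by
        rw [real_inner_smul_right, ha s hs hrs y hy, mul_zero] }
  have hRW : ∀ x ∈ W, R x ∈ W := fun x hx s hs hrs y hy => by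
    rw [← hR, hy, real_inner_smul_left, hx s hs hrs y hy, mul_zero]
  set T : E →L[ℝ] E := algebraMap ℝ (E →L[ℝ] E) r - R with hT
  have hTx : ∀ x, T x = r • x - R x := fun x => by simp [hT, Algebra.algebraMap_eq_smul_one]
  have key := inner_nonneg_on_of_shifts_bounded_below T (fun x y => by
    simp only [hTx, inner_sub_left, inner_sub_right, real_inner_smul_left, real_inner_smul_right,
      hR]) W (fun x hx => by rw [hTx]; exact W.sub_mem (W.smul_mem _ hx) (hRW x hx)) ?_
    (x := x) hx
  · rw [hTx, inner_sub_left, real_inner_smul_left, real_inner_self_eq_norm_sq] at key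
    linarith
  intro κ hκ
  set A : E →L[ℝ] E := R - algebraMap ℝ (E →L[ℝ] E) (r + κ) with hA
  have hAx : ∀ x, A x = R x - (r + κ) • x := fun x => by
    simp [hA, Algebra.algebraMap_eq_smul_one]
  have hAT : ∀ x, ‖T x + κ • x‖ = ‖A x‖ := fun x => by
    rw [hTx, hAx, ← norm_neg]; congr 1; module
  have hunit : ∀ s, s ∉ spectrum ℝ R → IsUnit (R - algebraMap ℝ (E →L[ℝ] E) s) := fun s hs => by
    rw [← IsUnit.neg_iff, neg_sub]; exact spectrum.notMem_iff.1 hs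
  -- Off the spectrum `A` is invertible; on it, the point is isolated and `W` is orthogonal to the
  -- kernel of `A`.
  by_cases hs : r + κ ∈ spectrum ℝ R
  · obtain ⟨ε, hε, hiso⟩ := h _ hs (by linarith)
    obtain ⟨c, hc, hcx⟩ := exists_bounded_below_of_isolated A (fun x y => by
      simp only [hAx, inner_sub_left, inner_sub_right, real_inner_smul_left,
        real_inner_smul_right, hR]) hε (fun μ hμ hμε => by
      have h1 : A + algebraMap ℝ (E →L[ℝ] E) μ = R - algebraMap ℝ (E →L[ℝ] E) (r + κ - μ) := by
        rw [hA, map_sub]; abel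
      rw [h1]
      refine hunit _ fun hmem => hμ ?_
      have := hiso _ hmem (by rwa [show r + κ - μ - (r + κ) = -μ by ring, abs_neg])
      linarith)
    refine ⟨c, hc, fun x hx => ?_⟩
    rw [hAT]
    refine hcx x ((Submodule.mem_orthogonal _ _).2 fun y hy => hx _ hs (by linarith) y ?_)
    have h2 : A y = 0 := hy
    rw [hAx] at h2
    exact sub_eq_zero.1 h2
  · obtain ⟨c, hc, hcx⟩ := exists_bounded_below_of_isUnit (hunit _ hs)
    exact ⟨c, hc, fun x _ => by rw [hAT]; exact hcx x⟩

/-- By compactness, an infinite intersection would accumulate at one of its own points. -/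
theorem finite_spectrum_inter_of_isolated [CompleteSpace E] (R : E →L[ℝ] E) {r : ℝ}
    (h : ∀ s ∈ spectrum ℝ R, r ≤ s → ∃ ε : ℝ, 0 < ε ∧ ∀ t ∈ spectrum ℝ R, |t - s| < ε → t = s) :
    (spectrum ℝ R ∩ Set.Ici r).Finite := by
  by_contra hinf
  obtain ⟨s, hs, hacc⟩ := Set.Infinite.exists_accPt_of_subset_isCompact hinf
    ((spectrum.isCompact R).inter_right isClosed_Ici) subset_rfl
  obtain ⟨ε, hε, hiso⟩ := h s hs.1 hs.2
  obtain ⟨t, ⟨hts, ht⟩, hd⟩ :=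
    ((accPt_iff_frequently.1 hacc).and_eventually (Metric.ball_mem_nhds s hε)).exists
  exact hts (hiso t ht.1 (by simpa [Real.dist_eq] using hd))

end BoundedSymmetric

/-! ### Green's formula, ground state transform and positive superharmonic functions -/

/-- Definiteness makes the map to the dual injective, hence bijective in finite dimension. With `l`
an evaluation at a vertex, the solution is a Green's function. -/
theorem exists_mem_forall_eq_of_pos {V : Type*} [AddCommGroup V] [Module ℝ V]
    (B : V →ₗ[ℝ] V →ₗ[ℝ] ℝ) (M : Submodule ℝ V) [FiniteDimensional ℝ M]
    (h : ∀ x ∈ M, x ≠ 0 → 0 < B x x) (l : V →ₗ[ℝ] ℝ) : ∃ u ∈ M, ∀ v ∈ M, B u v = l v := by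
  let B' : M →ₗ[ℝ] Module.Dual ℝ M := B.compl₁₂ M.subtype M.subtype
  have hinj : Function.Injective B' := by
    rw [injective_iff_map_eq_zero]
    intro u hu
    by_contra hne
    have h1 := h u u.2 (by simpa using hne)
    have h2 : B u u = 0 := congrArg (fun k : Module.Dual ℝ M => k u) hu
    exact h1.ne' h2
  obtain ⟨u, hu⟩ := (LinearMap.injective_iff_surjective_of_finrank_eq_finrank
    Subspace.dual_finrank_eq.symm).1 hinj (l ∘ₗ M.subtype)
  exact ⟨u, u.2, fun v hv => congrArg (fun k : Module.Dual ℝ M => k ⟨v, hv⟩) hu⟩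

namespace SummableGraph

variable {X : Type*} (G : SummableGraph X)

theorem hasSum_prod_of_finite_support (c : X → ℝ) (g : X → X → ℝ) (hg : ∀ x, Summable (g x))
    (s : Finset X) (hs : ∀ x ∉ s, c x = 0) :
    HasSum (fun p : X × X => c p.1 * g p.1 p.2) (∑ x ∈ s, c x * ∑' y, g x y) := by
  classical
  have h1 : ∀ x ∈ s, HasSum (fun p : X × X => if p.1 = x then c x * g x p.2 else 0)
      (c x * ∑' y, g x y) := by
    intro x _
    rw [← (Prod.mk_right_injective x).hasSum_iff]
    · simpa [Function.comp_def] using (hg x).hasSum.mul_left (c x)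
    · rintro ⟨a, b⟩ hab
      have : a ≠ x := by
        rintro rfl
        exact hab ⟨b, rfl⟩
      simp [this]
  convert hasSum_sum h1 using 2 with p
  by_cases hp : p.1 ∈ s
  · rw [Finset.sum_eq_single p.1]
    · simp
    · intro x _ hx
      simp [hx.symm]
    · exact fun h => absurd hp h
  · rw [hs _ hp, zero_mul, Finset.sum_eq_zero]
    intro x hx
    have : p.1 ≠ x := by
      rintro rfl
      exact hp hx
    simp [this]

variable {G}

theorem summable_mul_of_mem {f : X → ℝ} (hf : f ∈ G.formalDomain) (x : X) :
    Summable fun y => G.b x y * f y := by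
  refine Summable.of_norm ((hf x).congr fun y => ?_)
  rw [Real.norm_eq_abs, abs_mul, abs_of_nonneg (G.nonneg x y)]

theorem summable_laplacian {f : X → ℝ} (hf : f ∈ G.formalDomain) (x : X) :
    Summable fun y => G.b x y * (f x - f y) := by
  simp only [mul_sub]
  exact ((G.locallySummable x).mul_right _).sub (summable_mul_of_mem hf x)

theorem laplacian_eq {f : X → ℝ} (hf : f ∈ G.formalDomain) (x : X) :
    G.laplacian f x = (∑' y, G.b x y) * f x - ∑' y, G.b x y * f y := by
  simp only [laplacian, mul_sub]
  rw [((G.locallySummable x).mul_right _).tsum_sub (summable_mul_of_mem hf x), tsum_mul_right]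

theorem finsupp_mem_formalDomain (φ : X →₀ ℝ) : ⇑φ ∈ G.formalDomain := fun x =>
  summable_of_ne_finset_zero (s := φ.support) fun y hy => by simp [Finsupp.notMem_support_iff.1 hy]

/-- Green's formula for `v` in `F(X)`, in symmetrised form: the two summands are exchanged by
swapping the endpoints of an edge. Finite support of `c` gives convergence. -/
theorem hasSum_mul_grad {v : X → ℝ} (hv : v ∈ G.formalDomain) (c : X → ℝ) (s : Finset X)
    (hs : ∀ x ∉ s, c x = 0) :
    HasSum (fun p : X × X =>
      G.b p.1 p.2 * (c p.1 * (v p.1 - v p.2)) + G.b p.1 p.2 * (c p.2 * (v p.2 - v p.1)))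
      (2 * ∑ x ∈ s, c x * G.laplacian v x) := by
  have h1 := hasSum_prod_of_finite_support c (fun x y => G.b x y * (v x - v y))
    (fun x => summable_laplacian hv x) s hs
  have h2 := (Equiv.prodComm X X).hasSum_iff.2 h1
  rw [two_mul]
  refine Eq.subst (motive := fun F => HasSum F _) (funext fun p => ?_) (h1.add h2)
  simp only [Function.comp, Equiv.prodComm_apply, Prod.fst_swap, Prod.snd_swap]
  rw [G.symm p.2 p.1]
  ring

theorem hasSum_form (φ ψ : X →₀ ℝ) (s : Finset X) (hs : ∀ x ∉ s, ψ x = 0) :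
    HasSum (fun p : X × X => G.b p.1 p.2 * (φ p.1 - φ p.2) * (ψ p.1 - ψ p.2))
      (2 * ∑ x ∈ s, ψ x * G.laplacian φ x) := by
  convert hasSum_mul_grad (finsupp_mem_formalDomain φ) ψ s hs using 2 with p
  ring

theorem form_eq_sum (q : X → ℝ) (φ ψ : X →₀ ℝ) (s : Finset X) (hs : ∀ x ∉ s, ψ x = 0) :
    G.form q φ ψ = ∑ x ∈ s, ψ x * G.schrodinger q φ x := by
  rw [form, (hasSum_form φ ψ s hs).tsum_eq, tsum_eq_sum (s := s) fun x hx => by simp [hs x hx],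
    one_div, inv_mul_cancel_left₀ two_ne_zero, ← Finset.sum_add_distrib]
  refine Finset.sum_congr rfl fun x _ => ?_
  rw [schrodinger]; ring

theorem form_comm (q : X → ℝ) (φ ψ : X →₀ ℝ) : G.form q φ ψ = G.form q ψ φ := by
  simp only [form, mul_assoc, mul_comm (φ _ - φ _), mul_comm (φ _)]

theorem form_add_right (q : X → ℝ) (φ ψ χ : X →₀ ℝ) :
    G.form q φ (ψ + χ) = G.form q φ ψ + G.form q φ χ := by
  classical
  have h1 : ∀ x ∉ ψ.support ∪ χ.support, ψ x = 0 ∧ χ x = 0 := fun x hx => by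
    simpa [not_or] using hx
  rw [form_eq_sum q φ (ψ + χ) (ψ.support ∪ χ.support) fun x hx => by simp [h1 x hx],
    form_eq_sum q φ ψ (ψ.support ∪ χ.support) fun x hx => (h1 x hx).1,
    form_eq_sum q φ χ (ψ.support ∪ χ.support) fun x hx => (h1 x hx).2, ← Finset.sum_add_distrib]
  refine Finset.sum_congr rfl fun x _ => ?_
  rw [Finsupp.add_apply, add_mul]

theorem form_smul_right (q : X → ℝ) (c : ℝ) (φ ψ : X →₀ ℝ) :
    G.form q φ (c • ψ) = c * G.form q φ ψ := by
  rw [form_eq_sum q φ (c • ψ) ψ.support fun x hx => by simp_all,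
    form_eq_sum q φ ψ ψ.support fun x hx => by simp_all, Finset.mul_sum]
  refine Finset.sum_congr rfl fun x _ => ?_
  rw [Finsupp.smul_apply, smul_eq_mul, mul_assoc]

variable (G) in
/-- The form `h` as a bilinear map. -/
noncomputable def formBilin (q : X → ℝ) : (X →₀ ℝ) →ₗ[ℝ] (X →₀ ℝ) →ₗ[ℝ] ℝ :=
  LinearMap.mk₂ ℝ (G.form q)
    (fun φ φ' ψ => by rw [form_comm, form_add_right, form_comm q ψ, form_comm q ψ])
    (fun c φ ψ => by rw [form_comm, form_smul_right, form_comm q ψ, smul_eq_mul])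
    (form_add_right q) (fun c φ ψ => form_smul_right q c φ ψ)

theorem form_add_potential (q p : X → ℝ) (φ : X →₀ ℝ) (s : Finset X) (hs : ∀ x ∉ s, φ x = 0) :
    G.form (q + p) φ φ = G.form q φ φ + ∑ x ∈ s, p x * φ x ^ 2 := by
  rw [form_eq_sum _ φ φ s hs, form_eq_sum _ φ φ s hs, ← Finset.sum_add_distrib]
  refine Finset.sum_congr rfl fun x _ => ?_
  simp only [schrodinger, Pi.add_apply]; ring

/-- The ground state transform. -/
theorem hasSum_groundState {u : X → ℝ} (hu : u ∈ G.formalDomain) (q f g : X → ℝ) (φ ψ : X →₀ ℝ)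
    (hφ : ∀ x, φ x = f x * u x) (hψ : ∀ x, ψ x = g x * u x) (s : Finset X)
    (hs : ∀ x ∉ s, ψ x = 0) :
    HasSum (fun p : X × X =>
      G.b p.1 p.2 * (u p.1 * u p.2) * ((f p.1 - f p.2) * (g p.1 - g p.2)))
      (2 * (G.form q φ ψ - ∑ x ∈ s, f x * ψ x * G.schrodinger q u x)) := by
  have h1 := hasSum_form (G := G) φ ψ s hs
  have h2 := hasSum_mul_grad hu (fun x => f x * ψ x) s fun x hx => by simp [hs x hx]
  have h3 : 2 * (G.form q φ ψ - ∑ x ∈ s, f x * ψ x * G.schrodinger q u x)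
      = 2 * ∑ x ∈ s, ψ x * G.laplacian φ x - 2 * ∑ x ∈ s, f x * ψ x * G.laplacian u x := by
    rw [form_eq_sum q φ ψ s hs, ← mul_sub, ← Finset.sum_sub_distrib, ← Finset.sum_sub_distrib]
    congr 1
    refine Finset.sum_congr rfl fun x _ => ?_
    rw [schrodinger, schrodinger, hφ x]; ring
  rw [h3]
  -- Termwise, subtracting the Green's formula for `u` with weight `f ψ` cancels the squares `u(x)²`
  -- and `u(y)²` and leaves `u(x) u(y)` times the product of differences.
  refine Eq.subst (motive := fun F => HasSum F _) (funext fun p => ?_) (h1.sub h2)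
  rw [hφ, hφ, hψ, hψ]; ring

/-- A nonnegative superharmonic function makes the form nonnegative on the functions supported where
it is superharmonic and positive. -/
theorem form_nonneg_of_superharmonic {q u : X → ℝ} {K : Set X}
    (hu : G.IsNonnegSuperharmonicOn q Kᶜ u) (hpos : ∀ x ∉ K, 0 < u x) (φ : X →₀ ℝ)
    (hφ : ∀ x ∈ K, φ x = 0) : 0 ≤ G.form q φ φ := by
  have hf : ∀ x, φ x = φ x / u x * u x := by
    intro x
    by_cases hx : x ∈ K
    · simp [hφ x hx]
    · rw [div_mul_cancel₀ _ (hpos x hx).ne']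
  have h1 := hasSum_groundState hu.1 q (fun x => φ x / u x) (fun x => φ x / u x) φ φ hf hf
    φ.support (by simp)
  have h2 := h1.nonneg fun p => mul_nonneg (mul_nonneg (G.nonneg _ _)
    (mul_nonneg (hu.2.1 _) (hu.2.1 _))) (mul_self_nonneg _)
  have h3 : 0 ≤ ∑ x ∈ φ.support, φ x / u x * φ x * G.schrodinger q u x := by
    refine Finset.sum_nonneg fun x hx => mul_nonneg ?_ (hu.2.2 x fun hK => ?_)
    · rw [div_mul_eq_mul_div]
      exact div_nonneg (mul_self_nonneg _) (hu.2.1 x)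
    · exact (Finsupp.mem_support_iff.1 hx) (hφ x hK)
  linarith

theorem tsum_mul_le_of_superharmonic {q u : X → ℝ} (hu : u ∈ G.formalDomain) {x : X}
    (h : 0 ≤ G.schrodinger q u x) : ∑' y, G.b x y * u y ≤ ((∑' y, G.b x y) + q x) * u x := by
  rw [schrodinger, laplacian_eq hu] at h
  linarith

/-- The strong minimum principle. -/
theorem pos_of_superharmonic (hG : G.Connected) {q u : X → ℝ}
    (hu : G.IsNonnegSuperharmonicOn q Set.univ u) (hne : u ≠ 0) (x : X) : 0 < u x := by
  by_contra hx
  have hx0 : u x = 0 := le_antisymm (not_lt.1 hx) (hu.2.1 x)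
  refine hne (funext fun y => ?_)
  induction hG x y with
  | refl => exact hx0
  | @tail y z _ hyz ih =>
    have ih : u y = 0 := ih
    have h1 := tsum_mul_le_of_superharmonic hu.1 (hu.2.2 y trivial)
    rw [ih, mul_zero] at h1
    have h2 := (summable_mul_of_mem hu.1 y).le_tsum z
      fun w _ => mul_nonneg (G.nonneg y w) (hu.2.1 w)
    have h3 := hu.2.1 z
    show u z = 0
    by_contra h4
    have := mul_pos hyz (lt_of_le_of_ne h3 (Ne.symm h4))
    linarith

/-- The diagonal products vanish by disjointness of supports, and the surviving cross terms carry a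
minus sign. -/
theorem form_posPart_negPart_nonpos (q : X → ℝ) (φ ψ : X →₀ ℝ) (hφ : ∀ x, 0 ≤ φ x)
    (hψ : ∀ x, 0 ≤ ψ x) (h : ∀ x, φ x * ψ x = 0) : G.form q φ ψ ≤ 0 := by
  have h1 : ∑' p : X × X, G.b p.1 p.2 * (φ p.1 - φ p.2) * (ψ p.1 - ψ p.2) ≤ 0 := by
    refine tsum_nonpos fun p => ?_
    rw [mul_assoc]
    refine mul_nonpos_of_nonneg_of_nonpos (G.nonneg _ _) ?_
    have := mul_nonneg (hφ p.1) (hψ p.2)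
    have := mul_nonneg (hφ p.2) (hψ p.1)
    have := h p.1
    have := h p.2
    nlinarith
  have h2 : ∑' x, q x * φ x * ψ x = 0 := by
    simp [mul_assoc, h]
  rw [form, h2]
  linarith

theorem schrodinger_eq_form_single (q : X → ℝ) (φ : X →₀ ℝ) (x : X) :
    G.schrodinger q φ x = G.form q φ (Finsupp.single x 1) := by
  classical
  rw [form_eq_sum q φ _ {x} fun y hy => by
    rw [Finsupp.single_apply, if_neg]; rintro rfl; simp at hy]
  simp

/-- Green's function of a finite set. -/
theorem exists_finsupp_superharmonic {q : X → ℝ} (h : ∀ φ : X →₀ ℝ, φ ≠ 0 → 0 < G.form q φ φ)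
    (K : Finset X) {o : X} (ho : o ∈ K) :
    ∃ u : X →₀ ℝ, (∀ x, 0 ≤ u x) ∧ u o = 1 ∧ ∀ x ∈ K, 0 ≤ G.schrodinger q u x := by
  classical
  set M := Finsupp.supported ℝ ℝ (K : Set X)
  have : FiniteDimensional ℝ M :=
    LinearEquiv.finiteDimensional (Finsupp.supportedEquivFinsupp (K : Set X)).symm
  obtain ⟨u, huM, huv⟩ := exists_mem_forall_eq_of_pos (G.formBilin q) M (fun φ _ hφ => h φ hφ)
    (Finsupp.lapply o)
  replace huv : ∀ v ∈ M, G.form q u v = v o := huv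
  have hsingle : ∀ x ∈ K, Finsupp.single x (1 : ℝ) ∈ M := fun x hx =>
    Finsupp.single_mem_supported ℝ 1 (by simpa using hx)
  set v : X →₀ ℝ := u.mapRange (fun t => max (-t) 0) (by simp) with hv
  set w : X →₀ ℝ := u.mapRange (fun t => max t 0) (by simp) with hw
  have hvx : ∀ x, v x = max (-u x) 0 := fun x => by simp [hv]
  have hwx : ∀ x, w x = max (u x) 0 := fun x => by simp [hw]
  have huvw : w = u + v := by
    ext x
    rw [Finsupp.add_apply, hvx, hwx]
    rcases le_total (u x) 0 with h0 | h0 <;> simp [h0]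
  have hvM : v ∈ M := by
    rw [Finsupp.mem_supported] at huM ⊢
    exact (Finset.coe_subset.2 Finsupp.support_mapRange).trans huM
  have h1 : G.form q v w ≤ 0 := form_posPart_negPart_nonpos q v w (fun x => by simp [hvx])
    (fun x => by simp [hwx]) fun x => by
      rw [hvx, hwx]
      rcases le_total (u x) 0 with h0 | h0 <;> simp [h0]
  -- For the negative part `v` of `u`, `h(v,v) = h(v,w) - h(u,v)`, where the first term is
  -- nonpositive and `h(u,v) = v(o) ≥ 0`.
  have h2 : G.form q v v ≤ 0 := by
    rw [huvw, form_add_right, form_comm, huv v hvM] at h1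
    have : 0 ≤ v o := by simp [hvx]
    linarith
  have hv0 : v = 0 := by
    by_contra hne
    exact absurd h2 (not_le.2 (h v hne))
  have hu0 : ∀ x, 0 ≤ u x := fun x => by
    have : v x = 0 := by rw [hv0]; rfl
    rw [hvx, max_eq_right_iff] at this
    linarith
  have hune : u ≠ 0 := by
    rintro rfl
    have := huv _ (hsingle o ho)
    rw [← schrodinger_eq_form_single] at this
    simp [schrodinger, laplacian] at this
  have huo : 0 < u o := by
    rw [← huv u huM]; exact h u hune
  refine ⟨(u o)⁻¹ • u, fun x => ?_, ?_, fun x hx => ?_⟩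
  · exact mul_nonneg (inv_nonneg.2 huo.le) (hu0 x)
  · simp [huo.ne']
  · rw [schrodinger_eq_form_single, form_comm, form_smul_right, form_comm, huv _ (hsingle x hx)]
    refine mul_nonneg (inv_nonneg.2 huo.le) ?_
    rw [Finsupp.single_apply]; split_ifs <;> norm_num

/-- The Allegretto-Piepenbrink theorem: if the form is nonnegative, there is a positive
superharmonic function. -/
theorem exists_superharmonic (hG : G.Connected) {q : X → ℝ} (hq : ∀ φ : X →₀ ℝ, 0 ≤ G.form q φ φ)
    (o : X) : ∃ u, G.IsNonnegSuperharmonicOn q Set.univ u ∧ u o = 1 := by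
  classical
  have hstrict : ∀ n : ℕ, ∀ φ : X →₀ ℝ, φ ≠ 0 →
      0 < G.form (q + fun _ => 1 / ((n : ℝ) + 1)) φ φ := by
    intro n φ hφ
    rw [form_add_potential q _ φ φ.support (by simp)]
    refine add_pos_of_nonneg_of_pos (hq φ) (Finset.sum_pos (fun x hx => ?_)
      (Finsupp.support_nonempty_iff.2 hφ))
    have := Finsupp.mem_support_iff.1 hx
    positivity
  -- One Green's function for each exhausting finite set and each shift `1/(n+1)`; the shift
  -- supplies strict positivity and disappears in the limit.
  choose v hv0 hvo hv using fun i : Finset X × ℕ =>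
    exists_finsupp_superharmonic (hstrict i.2) (insert o i.1) (Finset.mem_insert_self o i.1)
  have hsum : ∀ x, ∀ T : Finset X, ∀ᶠ i : Finset X × ℕ in atTop,
      ∑ y ∈ T, G.b x y * v i y ≤ ((∑' y, G.b x y) + (q x + 1 / ((i.2 : ℝ) + 1))) * v i x := by
    intro x T
    filter_upwards [eventually_ge_atTop (({x} : Finset X), 0)] with i hi
    have hx : x ∈ insert o i.1 :=
      Finset.mem_insert_of_mem (Finset.singleton_subset_iff.1 hi.1)
    have h1 := tsum_mul_le_of_superharmonic (finsupp_mem_formalDomain (v i)) (hv i x hx)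
    exact ((summable_mul_of_mem (finsupp_mem_formalDomain (v i)) x).sum_le_tsum T
      fun y _ => mul_nonneg (G.nonneg _ _) (hv0 i y)).trans h1
  -- Harnack along paths from `o`: superharmonicity at `y` bounds `b(y,z) v(z)` by a multiple of
  -- `v(y)`.
  have hbdd : ∀ x, ∃ C : ℝ, ∀ᶠ i : Finset X × ℕ in atTop, v i x ≤ C := by
    intro x
    induction hG o x with
    | refl => exact ⟨1, Eventually.of_forall fun i => (hvo i).le⟩
    | @tail y z _ hyz ih =>
      obtain ⟨C, hC⟩ := ih
      refine ⟨(|(∑' w, G.b y w) + q y| + 1) * C / G.b y z, ?_⟩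
      filter_upwards [hC, hsum y {z}] with i hi hs
      rw [le_div_iff₀ hyz, mul_comm]
      rw [Finset.sum_singleton] at hs
      have h1 : (1 : ℝ) / ((i.2 : ℝ) + 1) ≤ 1 := by
        rw [div_le_one (by positivity)]
        linarith [(Nat.cast_nonneg i.2 : (0 : ℝ) ≤ i.2)]
      have h2 := le_abs_self ((∑' w, G.b y w) + q y)
      calc G.b y z * v i z ≤ _ := hs
        _ ≤ (|(∑' w, G.b y w) + q y| + 1) * v i y :=
            mul_le_mul_of_nonneg_right (by linarith) (hv0 i y)
        _ ≤ _ := by gcongr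
  -- An ultrafilter gives simultaneous pointwise limits without extracting a diagonal sequence.
  set U : Ultrafilter (Finset X × ℕ) := Ultrafilter.of atTop
  have hU : (U : Filter (Finset X × ℕ)) ≤ atTop := Ultrafilter.of_le _
  have hlim : ∀ x, ∃ l : ℝ, Tendsto (fun i => v i x) U (𝓝 l) := by
    intro x
    obtain ⟨C, hC⟩ := hbdd x
    have h1 : (U.map fun i => v i x : Filter ℝ) ≤ 𝓟 (Set.Icc 0 C) := by
      rw [le_principal_iff]
      have h2 : ∀ᶠ i in (U : Filter (Finset X × ℕ)), v i x ∈ Set.Icc 0 C :=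
        (hC.filter_mono hU).mono fun i hi => ⟨hv0 i x, hi⟩
      exact h2
    obtain ⟨l, -, hl⟩ := isCompact_Icc.ultrafilter_le_nhds (U.map fun i => v i x) h1
    exact ⟨l, hl⟩
  choose u hu using hlim
  have hu0 : ∀ x, 0 ≤ u x := fun x =>
    ge_of_tendsto (hu x) (Eventually.of_forall fun i => hv0 i x)
  have hα : Tendsto (fun i : Finset X × ℕ => 1 / ((i.2 : ℝ) + 1)) U (𝓝 0) := by
    have h1 : Tendsto (fun i : Finset X × ℕ => i.2) atTop atTop := by
      rw [← prod_atTop_atTop_eq]; exact tendsto_snd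
    exact (tendsto_one_div_add_atTop_nhds_zero_nat.comp h1).mono_left hU
  -- Fatou: only finite partial sums pass to the limit. The resulting bound gives both `u ∈ F(X)`
  -- and superharmonicity.
  have hle : ∀ x, ∀ T : Finset X,
      ∑ y ∈ T, G.b x y * u y ≤ ((∑' y, G.b x y) + q x) * u x := by
    intro x T
    have h1 : Tendsto (fun i => ∑ y ∈ T, G.b x y * v i y) U (𝓝 (∑ y ∈ T, G.b x y * u y)) :=
      tendsto_finsetSum _ fun y _ => (hu y).const_mul _
    have h2 : Tendsto (fun i : Finset X × ℕ =>
        ((∑' y, G.b x y) + (q x + 1 / ((i.2 : ℝ) + 1))) * v i x) U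
        (𝓝 (((∑' y, G.b x y) + (q x + 0)) * u x)) :=
      ((hα.const_add _).const_add _).mul (hu x)
    rw [add_zero] at h2
    exact le_of_tendsto_of_tendsto h1 h2 (hU (hsum x T))
  have hF : u ∈ G.formalDomain := fun x => by
    refine summable_of_sum_le (c := ((∑' y, G.b x y) + q x) * u x)
      (fun y => mul_nonneg (G.nonneg _ _) (abs_nonneg _)) fun T => ?_
    simpa only [abs_of_nonneg (hu0 _)] using hle x T
  refine ⟨u, ⟨hF, hu0, fun x _ => ?_⟩, ?_⟩
  · have h1 := (summable_mul_of_mem hF x).tsum_le_of_sum_le (hle x)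
    rw [schrodinger, laplacian_eq hF]
    linarith
  · exact tendsto_nhds_unique (hu o) (tendsto_const_nhds.congr fun i => (hvo i).symm)

end SummableGraph

/-! ### The unitary identification of `ℓ²(X)` with `ℓ²(X, m)` -/

section SquareSummable

open scoped InnerProductSpace

/-- The unweighted real sequence space `ℓ²(X)`. -/
abbrev SqSummable (X : Type*) := lp (fun _ : X => ℝ) 2

variable {X : Type*}

theorem memlp_two_iff (f : X → ℝ) : Memℓp f 2 ↔ Summable fun x => f x ^ 2 := by
  rw [memℓp_gen_iff (by norm_num)]
  simp

theorem SqSummable.inner_eq (f g : SqSummable X) : ⟪f, g⟫_ℝ = ∑' x, f x * g x := by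
  rw [lp.inner_eq_tsum]
  simp [mul_comm]

theorem SqSummable.tendsto_apply {ι : Type*} {l : Filter ι} {f : ι → SqSummable X}
    {g : SqSummable X} (h : Tendsto f l (𝓝 g)) (x : X) :
    Tendsto (fun i => f i x) l (𝓝 (g x)) :=
  ((lp.evalCLM ℝ (fun _ : X => ℝ) 2 x).continuous.tendsto g).comp h

/-- The identification of `ℓ²(X)` with `ℓ²(X, m)`. -/
noncomputable def ofSq (m : X → ℝ) : SqSummable X →ₗ[ℝ] (X → ℝ) where
  toFun e x := e x / √(m x)
  map_add' e f := by ext x; simp [add_div]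
  map_smul' c e := by ext x; simp [mul_div_assoc]

theorem ofSq_apply (m : X → ℝ) (e : SqSummable X) (x : X) : ofSq m e x = e x / √(m x) := rfl

variable {m : X → ℝ} (hm : ∀ x, 0 < m x)
include hm

theorem ofSq_injective : Function.Injective (ofSq m) := by
  rw [injective_iff_map_eq_zero]
  intro e he
  ext x
  have h1 := congrFun he x
  rw [ofSq_apply, Pi.zero_apply, div_eq_zero_iff] at h1
  exact h1.resolve_right (Real.sqrt_pos.2 (hm x)).ne'

theorem ofSq_mul_ofSq (e f : SqSummable X) (x : X) :
    ofSq m e x * ofSq m f x * m x = e x * f x := by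
  have h1 := Real.mul_self_sqrt (hm x).le
  have h2 := (Real.sqrt_pos.2 (hm x)).ne'
  rw [ofSq_apply, ofSq_apply]
  nth_rewrite 3 [← h1]
  field_simp

theorem memL2_ofSq (e : SqSummable X) : MemL2 m (ofSq m e) := by
  refine ((memlp_two_iff _).1 (lp.memℓp e)).congr fun x => ?_
  rw [sq, sq, ofSq_mul_ofSq hm]

theorem exists_ofSq_eq {f : X → ℝ} (hf : MemL2 m f) : ∃ e, ofSq m e = f := by
  refine ⟨⟨fun x => f x * √(m x), (memlp_two_iff _).2 (hf.congr fun x => ?_)⟩, ?_⟩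
  · rw [mul_pow, Real.sq_sqrt (hm x).le]
  · ext x
    rw [ofSq_apply]
    exact mul_div_cancel_right₀ _ (Real.sqrt_pos.2 (hm x)).ne'

theorem l2Inner_ofSq (e f : SqSummable X) : l2Inner m (ofSq m e) (ofSq m f) = ⟪e, f⟫_ℝ := by
  simp only [l2Inner, ofSq_mul_ofSq hm, SqSummable.inner_eq]

theorem l2Norm_ofSq (e : SqSummable X) : l2Norm m (ofSq m e) = ‖e‖ := by
  rw [l2Norm, l2Inner_ofSq hm, real_inner_self_eq_norm_sq, Real.sqrt_sq (norm_nonneg _)]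

omit hm

variable (m) in
/-- The embedding of the finitely supported functions into `ℓ²(X)`. -/
noncomputable def finsuppSq : (X →₀ ℝ) →ₗ[ℝ] SqSummable X where
  toFun φ := ⟨fun x => φ x * √(m x), (memlp_two_iff _).2 <|
    summable_of_ne_finset_zero (s := φ.support) fun x hx => by
      simp [Finsupp.notMem_support_iff.1 hx]⟩
  map_add' φ ψ := by ext x; exact add_mul _ _ _
  map_smul' c φ := by ext x; exact mul_assoc _ _ _

theorem finsuppSq_apply (φ : X →₀ ℝ) (x : X) : finsuppSq m φ x = φ x * √(m x) := rfl

include hm in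
theorem ofSq_finsuppSq (φ : X →₀ ℝ) : ofSq m (finsuppSq m φ) = φ := by
  ext x
  rw [ofSq_apply, finsuppSq_apply, mul_div_cancel_right₀ _ (Real.sqrt_pos.2 (hm x)).ne']

theorem inner_finsuppSq (e : SqSummable X) (φ : X →₀ ℝ) (s : Finset X) (hs : ∀ x ∉ s, φ x = 0) :
    ⟪e, finsuppSq m φ⟫_ℝ = ∑ x ∈ s, e x * finsuppSq m φ x := by
  rw [SqSummable.inner_eq, tsum_eq_sum fun x hx => ?_]
  simp [finsuppSq_apply, hs x hx]

include hm in
theorem norm_sq_finsuppSq (φ : X →₀ ℝ) (s : Finset X) (hs : ∀ x ∉ s, φ x = 0) :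
    ‖finsuppSq m φ‖ ^ 2 = ∑ x ∈ s, m x * φ x ^ 2 := by
  rw [← real_inner_self_eq_norm_sq, inner_finsuppSq _ _ s hs]
  refine Finset.sum_congr rfl fun x _ => ?_
  rw [finsuppSq_apply, ← Real.sq_sqrt (hm x).le, Real.sqrt_sq (Real.sqrt_nonneg _)]
  ring

end SquareSummable

/-! ### Closability of the form -/

namespace SummableGraph

open scoped InnerProductSpace

variable {X : Type*} {G : SummableGraph X}

theorem form_sub_smul (q : X → ℝ) {m : X → ℝ} (hm : ∀ x, 0 < m x) (t : ℝ) (φ : X →₀ ℝ) :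
    G.form (q - t • m) φ φ = G.form q φ φ - t * ‖finsuppSq m φ‖ ^ 2 := by
  rw [sub_eq_add_neg, form_add_potential q _ φ φ.support (by simp),
    norm_sq_finsuppSq hm φ φ.support (by simp), Finset.mul_sum, sub_eq_add_neg,
    ← Finset.sum_neg_distrib]
  congr 1
  refine Finset.sum_congr rfl fun x _ => ?_
  simp only [Pi.neg_apply, Pi.smul_apply, smul_eq_mul]
  ring

/-- The form is the square of a closable gradient. -/
theorem exists_gradient [Nonempty X] (hG : G.Connected) {q : X → ℝ}
    (hq : ∀ φ : X →₀ ℝ, 0 ≤ G.form q φ φ) {m : X → ℝ} (hm : ∀ x, 0 < m x) :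
    ∃ a : (X →₀ ℝ) →ₗ[ℝ] WithLp 2 (SqSummable X × SqSummable (X × X)),
      (∀ φ ψ, ⟪a φ, a ψ⟫_ℝ = G.form q φ ψ) ∧
      ∀ (φ : ℕ → X →₀ ℝ) (w : WithLp 2 (SqSummable X × SqSummable (X × X))),
        Tendsto (fun n => finsuppSq m (φ n)) atTop (𝓝 0) →
        Tendsto (fun n => a (φ n)) atTop (𝓝 w) → w = 0 := by
  obtain ⟨o⟩ := ‹Nonempty X›
  obtain ⟨u, hu, huo⟩ := exists_superharmonic hG hq o
  have hpos := pos_of_superharmonic hG hu (fun h => by simp [h] at huo)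
  -- Square roots of the potential and edge weights in the ground state transform; superharmonicity
  -- makes the radicand nonnegative.
  set κ : X → ℝ := fun x => √(G.schrodinger q u x / u x) with hκ
  set β : X × X → ℝ := fun p => √(G.b p.1 p.2 * (u p.1 * u p.2) / 2) with hβ
  have hκ2 : ∀ x, κ x * κ x = G.schrodinger q u x / u x := fun x =>
    Real.mul_self_sqrt (div_nonneg (hu.2.2 x trivial) (hpos x).le)
  have hβ2 : ∀ p, β p * β p = G.b p.1 p.2 * (u p.1 * u p.2) / 2 := fun p =>
    Real.mul_self_sqrt (div_nonneg (mul_nonneg (G.nonneg _ _)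
      (mul_pos (hpos _) (hpos _)).le) zero_le_two)
  have hgs := fun (φ ψ : X →₀ ℝ) => hasSum_groundState hu.1 q (fun x => φ x / u x)
    (fun x => ψ x / u x) φ ψ (fun x => (div_mul_cancel₀ _ (hpos x).ne').symm)
    (fun x => (div_mul_cancel₀ _ (hpos x).ne').symm) ψ.support (by simp)
  have hβφ : ∀ φ ψ : X →₀ ℝ, HasSum (fun p : X × X =>
      β p * (φ p.1 / u p.1 - φ p.2 / u p.2) * (β p * (ψ p.1 / u p.1 - ψ p.2 / u p.2)))
      (G.form q φ ψ - ∑ x ∈ ψ.support, φ x / u x * ψ x * G.schrodinger q u x) := by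
    intro φ ψ
    have h1 := (hgs φ ψ).mul_left (1 / 2)
    rw [one_div, inv_mul_cancel_left₀ two_ne_zero] at h1
    refine Eq.subst (motive := fun F => HasSum F _) (funext fun p => ?_) h1
    rw [mul_mul_mul_comm (β p), hβ2]
    ring
  have hmem1 : ∀ φ : X →₀ ℝ, Memℓp (fun x => κ x * φ x) 2 := fun φ =>
    (memlp_two_iff _).2 <| summable_of_ne_finset_zero (s := φ.support) fun x hx => by
      simp [Finsupp.notMem_support_iff.1 hx]
  have hmem2 : ∀ φ : X →₀ ℝ,
      Memℓp (fun p : X × X => β p * (φ p.1 / u p.1 - φ p.2 / u p.2)) 2 := fun φ =>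
    (memlp_two_iff _).2 ((hβφ φ φ).summable.congr fun p => (sq _).symm)
  let a : (X →₀ ℝ) →ₗ[ℝ] WithLp 2 (SqSummable X × SqSummable (X × X)) :=
    { toFun := fun φ => WithLp.toLp 2 (⟨_, hmem1 φ⟩, ⟨_, hmem2 φ⟩)
      map_add' := fun φ ψ => by
        rw [← WithLp.toLp_add]
        congr 1
        refine Prod.ext ?_ ?_
        · ext x; exact mul_add _ _ _
        · ext p; change β p * ((φ p.1 + ψ p.1) / _ - (φ p.2 + ψ p.2) / _) = β p * _ + β p * _
          ring
      map_smul' := fun c φ => by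
        rw [← WithLp.toLp_smul]
        congr 1
        refine Prod.ext ?_ ?_
        · ext x; change κ x * (c * φ x) = c * (κ x * φ x)
          ring
        · ext p; change β p * ((c * φ p.1) / _ - (c * φ p.2) / _) = c * (β p * _)
          ring }
  have ha1 : ∀ φ x, (a φ).fst x = κ x * φ x := fun φ x => rfl
  have ha2 : ∀ φ p, (a φ).snd p = β p * (φ p.1 / u p.1 - φ p.2 / u p.2) := fun φ p => rfl
  refine ⟨a, fun φ ψ => ?_, fun φ w h0 hw => ?_⟩
  · rw [WithLp.prod_inner_apply]
    change ⟪(a φ).fst, (a ψ).fst⟫_ℝ + ⟪(a φ).snd, (a ψ).snd⟫_ℝ = _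
    rw [SqSummable.inner_eq, SqSummable.inner_eq]
    simp only [ha1, ha2]
    rw [(hβφ φ ψ).tsum_eq, tsum_eq_sum (s := ψ.support) fun x hx => by
      simp [Finsupp.notMem_support_iff.1 hx]]
    have h1 : ∑ x ∈ ψ.support, κ x * φ x * (κ x * ψ x)
        = ∑ x ∈ ψ.support, φ x / u x * ψ x * G.schrodinger q u x :=
      Finset.sum_congr rfl fun x _ => by rw [mul_mul_mul_comm, hκ2]; ring
    rw [h1]; ring
  · have hφ : ∀ x, Tendsto (fun n => φ n x) atTop (𝓝 0) := by
      intro x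
      have h1 := (SqSummable.tendsto_apply h0 x).div_const (√(m x))
      simpa [finsuppSq_apply, (Real.sqrt_pos.2 (hm x)).ne'] using h1
    have hw1 : Tendsto (fun n => (a (φ n)).fst) atTop (𝓝 w.fst) :=
      ((WithLp.fstL 2 ℝ _ _).continuous.tendsto w).comp hw
    have hw2 : Tendsto (fun n => (a (φ n)).snd) atTop (𝓝 w.snd) :=
      ((WithLp.sndL 2 ℝ _ _).continuous.tendsto w).comp hw
    have e1 : w.fst = 0 := by
      ext x
      refine tendsto_nhds_unique (SqSummable.tendsto_apply hw1 x) ?_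
      simpa [ha1] using (hφ x).const_mul (κ x)
    have e2 : w.snd = 0 := by
      ext p
      refine tendsto_nhds_unique (SqSummable.tendsto_apply hw2 p) ?_
      simpa [ha2] using (((hφ p.1).div_const (u p.1)).sub ((hφ p.2).div_const (u p.2))).const_mul
        (β p)
    exact WithLp.ofLp_injective 2 (Prod.ext e1 e2)

end SummableGraph

/-! ### The form space and the resolvent -/

namespace SummableGraph

open scoped InnerProductSpace

variable {X : Type*} {G : SummableGraph X}

section Resolvent

variable {F : Type*} [NormedAddCommGroup F] [InnerProductSpace ℝ F] {q m : X → ℝ}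
  (a : (X →₀ ℝ) →ₗ[ℝ] F)

/-- The embedding of the finitely supported functions into the form graph space. -/
noncomputable def graphEmbedding (m : X → ℝ) : (X →₀ ℝ) →ₗ[ℝ] WithLp 2 (SqSummable X × F) where
  toFun φ := WithLp.toLp 2 (finsuppSq m φ, a φ)
  map_add' φ ψ := by rw [← WithLp.toLp_add, map_add, map_add]; rfl
  map_smul' c φ := by rw [RingHom.id_apply, ← WithLp.toLp_smul, map_smul, map_smul]; rfl

/-- The form domain with the form norm. -/
noncomputable def formSpace (m : X → ℝ) : Submodule ℝ (WithLp 2 (SqSummable X × F)) :=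
  (LinearMap.range (graphEmbedding a m)).topologicalClosure

/-- The embedding of the form domain into `ℓ²`. -/
noncomputable def formInclusion (m : X → ℝ) : formSpace a m →L[ℝ] SqSummable X :=
  (WithLp.fstL 2 ℝ (SqSummable X) F).comp (formSpace a m).subtypeL

theorem formInclusion_apply (v : formSpace a m) : formInclusion a m v = v.1.fst := rfl

theorem graphEmbedding_mem (φ : X →₀ ℝ) : graphEmbedding a m φ ∈ formSpace a m :=
  Submodule.le_topologicalClosure _ ⟨φ, rfl⟩

theorem exists_seq_tendsto_formSpace (v : formSpace a m) :
    ∃ φ : ℕ → X →₀ ℝ, Tendsto (fun n => graphEmbedding a m (φ n)) atTop (𝓝 v) := by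
  have h1 : (v : WithLp 2 (SqSummable X × F)) ∈
      closure (LinearMap.range (graphEmbedding a m) : Set (WithLp 2 (SqSummable X × F))) := v.2
  obtain ⟨y, hy, hlim⟩ := mem_closure_iff_seq_limit.1 h1
  choose φ hφ using hy
  exact ⟨φ, by simpa only [hφ] using hlim⟩

theorem mem_formSpace_of_tendsto {φ : ℕ → X →₀ ℝ} {v : WithLp 2 (SqSummable X × F)}
    (h : Tendsto (fun n => graphEmbedding a m (φ n)) atTop (𝓝 v)) : v ∈ formSpace a m :=
  (Submodule.isClosed_topologicalClosure _).mem_of_tendsto h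
    (Eventually.of_forall fun n => graphEmbedding_mem a (φ n))

theorem tendsto_graphEmbedding_fst {φ : ℕ → X →₀ ℝ} {v : WithLp 2 (SqSummable X × F)}
    (h : Tendsto (fun n => graphEmbedding a m (φ n)) atTop (𝓝 v)) :
    Tendsto (fun n => finsuppSq m (φ n)) atTop (𝓝 v.fst) :=
  ((WithLp.fstL 2 ℝ (SqSummable X) F).continuous.tendsto v).comp h

theorem tendsto_graphEmbedding_snd {φ : ℕ → X →₀ ℝ} {v : WithLp 2 (SqSummable X × F)}
    (h : Tendsto (fun n => graphEmbedding a m (φ n)) atTop (𝓝 v)) :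
    Tendsto (fun n => a (φ n)) atTop (𝓝 v.snd) :=
  ((WithLp.sndL 2 ℝ (SqSummable X) F).continuous.tendsto v).comp h

/-- Closability of `a` says precisely that the closure of its graph has no vertical vector. -/
theorem formInclusion_injective
    (hcl : ∀ (φ : ℕ → X →₀ ℝ) (w : F), Tendsto (fun n => finsuppSq m (φ n)) atTop (𝓝 0) →
      Tendsto (fun n => a (φ n)) atTop (𝓝 w) → w = 0) :
    Function.Injective (formInclusion a m) := by
  rw [injective_iff_map_eq_zero]
  intro v hv
  obtain ⟨φ, hφ⟩ := exists_seq_tendsto_formSpace a v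
  have h1 := tendsto_graphEmbedding_fst a hφ
  rw [← formInclusion_apply, hv] at h1
  have h2 := hcl φ _ h1 (tendsto_graphEmbedding_snd a hφ)
  exact Subtype.ext (WithLp.ofLp_injective 2 (Prod.ext hv h2))

variable (ha : ∀ φ ψ, ⟪a φ, a ψ⟫_ℝ = G.form q φ ψ) (hm : ∀ x, 0 < m x)
include ha

theorem inner_graphEmbedding (φ ψ : X →₀ ℝ) :
    ⟪graphEmbedding a m φ, graphEmbedding a m ψ⟫_ℝ
      = ⟪finsuppSq m φ, finsuppSq m ψ⟫_ℝ + G.form q φ ψ := by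
  rw [WithLp.prod_inner_apply, ← ha]
  rfl

theorem norm_sq_graphEmbedding (φ : X →₀ ℝ) :
    ‖graphEmbedding a m φ‖ ^ 2 = ‖finsuppSq m φ‖ ^ 2 + G.form q φ φ := by
  rw [← real_inner_self_eq_norm_sq, inner_graphEmbedding a ha, real_inner_self_eq_norm_sq]

include hm

/-- Since `h(φ,φ) = ‖a φ‖²`, being `h`-Cauchy means that `a φₙ` converges, so approximating
sequences are the sequences converging in the closed graph. -/
theorem approximates_iff [CompleteSpace F] (φ : ℕ → X →₀ ℝ) (e : SqSummable X) :
    G.Approximates q m φ (ofSq m e) ↔ ∃ v : formSpace a m, formInclusion a m v = e ∧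
      Tendsto (fun n => graphEmbedding a m (φ n)) atTop (𝓝 v) := by
  have h1 : ∀ n, l2Norm m (⇑(φ n) - ofSq m e) = ‖finsuppSq m (φ n) - e‖ := fun n => by
    rw [← l2Norm_ofSq hm, map_sub, ofSq_finsuppSq hm]
  have h2 : ∀ p : ℕ × ℕ, G.form q (φ p.1 - φ p.2) (φ p.1 - φ p.2)
      = dist (a (φ p.1)) (a (φ p.2)) ^ 2 := fun p => by
    rw [← ha, real_inner_self_eq_norm_sq, map_sub, dist_eq_norm]
  simp only [Approximates, h1, h2]
  constructor
  · rintro ⟨h3, h4⟩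
    have h5 : CauchySeq fun n => a (φ n) := by
      rw [cauchySeq_iff_tendsto_dist_atTop_0]
      have := (Real.continuous_sqrt.tendsto 0).comp h4
      simpa [Function.comp_def, Real.sqrt_sq dist_nonneg] using this
    obtain ⟨w, hw⟩ := cauchySeq_tendsto_of_complete h5
    have h6 : Tendsto (fun n => graphEmbedding a m (φ n)) atTop (𝓝 (WithLp.toLp 2 (e, w))) :=
      ((WithLp.prod_continuous_toLp 2 _ _).tendsto (e, w)).comp
        ((tendsto_iff_norm_sub_tendsto_zero.2 h3).prodMk_nhds hw)
    exact ⟨⟨_, mem_formSpace_of_tendsto a h6⟩, rfl, h6⟩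
  · rintro ⟨v, rfl, hv⟩
    refine ⟨tendsto_iff_norm_sub_tendsto_zero.1 (tendsto_graphEmbedding_fst a hv), ?_⟩
    have h3 := (tendsto_graphEmbedding_snd a hv).cauchySeq
    rw [cauchySeq_iff_tendsto_dist_atTop_0] at h3
    simpa using h3.pow 2

/-- The form space carries `h + ⟨·,·⟩`, which accounts for `e + g`. Injectivity makes all
approximating sequences of one function share the same limit. -/
theorem mem_operator_iff [CompleteSpace F]
    (hinj : Function.Injective (formInclusion a m)) (e g : SqSummable X) :
    (ofSq m e, ofSq m g) ∈ G.operator q m ↔ ∃ v : formSpace a m, formInclusion a m v = e ∧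
      ∀ w : formSpace a m, ⟪v, w⟫_ℝ = ⟪e + g, formInclusion a m w⟫_ℝ := by
  have hform : ∀ (v w : formSpace a m) (φ ψ : ℕ → X →₀ ℝ),
      Tendsto (fun n => graphEmbedding a m (φ n)) atTop (𝓝 v) →
      Tendsto (fun n => graphEmbedding a m (ψ n)) atTop (𝓝 w) →
      Tendsto (fun n => G.form q (φ n) (ψ n)) atTop
        (𝓝 (⟪v, w⟫_ℝ - ⟪formInclusion a m v, formInclusion a m w⟫_ℝ)) := by
    intro v w φ ψ hφ hψ
    refine ((hφ.inner hψ).sub ((tendsto_graphEmbedding_fst a hφ).inner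
      (tendsto_graphEmbedding_fst a hψ))).congr fun n => ?_
    rw [inner_graphEmbedding a ha]; ring
  constructor
  · rintro ⟨⟨-, φ, hφ⟩, -, h⟩
    obtain ⟨v, rfl, hv⟩ := (approximates_iff a ha hm φ e).1 hφ
    refine ⟨v, rfl, fun w => ?_⟩
    obtain ⟨ψ, hψ⟩ := exists_seq_tendsto_formSpace a w
    have hψ' := (approximates_iff a ha hm ψ _).2 ⟨w, rfl, hψ⟩
    have h1 := h _ ⟨memL2_ofSq hm _, ψ, hψ'⟩ φ ψ hφ hψ'
    rw [l2Inner_ofSq hm] at h1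
    have h2 := tendsto_nhds_unique h1 (hform v w φ ψ hv hψ)
    rw [inner_add_left, h2]; ring
  · rintro ⟨v, rfl, h⟩
    obtain ⟨φ, hφ⟩ := exists_seq_tendsto_formSpace a v
    refine ⟨⟨memL2_ofSq hm _, φ, (approximates_iff a ha hm φ _).2 ⟨v, rfl, hφ⟩⟩,
      memL2_ofSq hm _, ?_⟩
    rintro k ⟨hk, -⟩ φ' ψ hφ' hψ
    obtain ⟨k, rfl⟩ := exists_ofSq_eq hm hk
    obtain ⟨v', hv', hφ'⟩ := (approximates_iff a ha hm φ' _).1 hφ'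
    obtain ⟨w, hw, hψ⟩ := (approximates_iff a ha hm ψ _).1 hψ
    have h1 := hform v' w φ' ψ hφ' hψ
    rw [hinj hv', h w, inner_add_left, add_sub_cancel_left, hw] at h1
    rwa [l2Inner_ofSq hm]

theorem mul_norm_sq_formInclusion_le {K : Finset X} {t : ℝ}
    (h : ∀ φ : X →₀ ℝ, (∀ x ∈ K, φ x = 0) → 0 ≤ G.form (q - t • m) φ φ) (v : formSpace a m)
    (hv : ∀ x ∈ K, formInclusion a m v x = 0) :
    (1 + t) * ‖formInclusion a m v‖ ^ 2 ≤ ‖v‖ ^ 2 := by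
  obtain ⟨φ, hφ⟩ := exists_seq_tendsto_formSpace a v
  -- Removing the values on `K` costs nothing in the limit: they tend to zero and `K` is finite.
  set ψ : ℕ → X →₀ ℝ := fun n => φ n - ∑ k ∈ K, φ n k • Finsupp.single k 1 with hψ
  have h1 : Tendsto (fun n => graphEmbedding a m (ψ n)) atTop (𝓝 v) := by
    have h2 : ∀ k ∈ K, Tendsto (fun n => φ n k • graphEmbedding a m (Finsupp.single k 1)) atTop
        (𝓝 0) := by
      intro k hk
      have h3 := (SqSummable.tendsto_apply (tendsto_graphEmbedding_fst a hφ) k).div_const (√(m k))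
      have h4 : (v : WithLp 2 (SqSummable X × F)).fst k = 0 := hv k hk
      rw [h4] at h3
      have h5 : Tendsto (fun n => φ n k) atTop (𝓝 0) := by
        simpa [finsuppSq_apply, (Real.sqrt_pos.2 (hm k)).ne'] using h3
      simpa using h5.smul_const (graphEmbedding a m (Finsupp.single k 1))
    have h6 := hφ.sub (tendsto_finsetSum K h2)
    simpa only [hψ, map_sub, map_sum, map_smul, Finset.sum_const_zero, sub_zero] using h6
  have h2 : ∀ n, (1 + t) * ‖finsuppSq m (ψ n)‖ ^ 2 ≤ ‖graphEmbedding a m (ψ n)‖ ^ 2 := by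
    intro n
    have h3 := h (ψ n) fun x hx => by
      classical
      simp [hψ, Finsupp.single_apply, hx]
    rw [form_sub_smul q hm] at h3
    rw [norm_sq_graphEmbedding a ha]
    linarith
  exact le_of_tendsto_of_tendsto (((tendsto_graphEmbedding_fst a h1).norm.pow 2).const_mul _)
    (h1.norm.pow 2) (Eventually.of_forall h2)

end Resolvent

theorem exists_inclusion_mul_adjoint {V E : Type*} [NormedAddCommGroup V] [InnerProductSpace ℝ V]
    [CompleteSpace V] [NormedAddCommGroup E] [InnerProductSpace ℝ E] [CompleteSpace E]
    (ι : V →L[ℝ] E) :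
    ∃ (J : E → V) (R : E →L[ℝ] E), (∀ x, ι (J x) = R x) ∧ (∀ x w, ⟪J x, w⟫_ℝ = ⟪x, ι w⟫_ℝ) ∧
      (∀ x y, ⟪R x, y⟫_ℝ = ⟪x, R y⟫_ℝ) ∧ ∀ x, ⟪R x, x⟫_ℝ = ‖J x‖ ^ 2 := by
  have h : ∀ x w, ⟪ContinuousLinearMap.adjoint ι x, w⟫_ℝ = ⟪x, ι w⟫_ℝ := fun x w =>
    ContinuousLinearMap.adjoint_inner_left ι w x
  have h' : ∀ x y, ⟪ι (ContinuousLinearMap.adjoint ι x), y⟫_ℝ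
      = ⟪ContinuousLinearMap.adjoint ι x, ContinuousLinearMap.adjoint ι y⟫_ℝ := fun x y => by
    rw [real_inner_comm, ← h, real_inner_comm]
  refine ⟨fun x => ContinuousLinearMap.adjoint ι x, ι ∘L ContinuousLinearMap.adjoint ι,
    fun x => rfl, h, fun x y => ?_, fun x => ?_⟩
  · exact (h' x y).trans (h x _)
  · exact (h' x x).trans (real_inner_self_eq_norm_sq _)

/-- The operator of the form is given by its resolvent at `-1`, a bounded nonnegative operator. -/
theorem exists_resolvent [Nonempty X] (hG : G.Connected) {q : X → ℝ}
    (hq : ∀ φ : X →₀ ℝ, 0 ≤ G.form q φ φ) {m : X → ℝ} (hm : ∀ x, 0 < m x) :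
    ∃ R : SqSummable X →L[ℝ] SqSummable X,
      (∀ x y, ⟪R x, y⟫_ℝ = ⟪x, R y⟫_ℝ) ∧ (∀ x, 0 ≤ ⟪R x, x⟫_ℝ) ∧
      (∀ e g, (ofSq m e, ofSq m g) ∈ G.operator q m ↔ R (e + g) = e) ∧
      (∀ (K : Finset X) (t : ℝ),
        (∀ φ : X →₀ ℝ, (∀ x ∈ K, φ x = 0) → 0 ≤ G.form (q - t • m) φ φ) →
        ∀ x, (∀ k ∈ K, R x k = 0) → (1 + t) * ⟪R x, x⟫_ℝ ≤ ‖x‖ ^ 2) ∧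
      ∀ (y : SqSummable X) (φ : X →₀ ℝ), ⟪y, finsuppSq m φ⟫_ℝ ^ 2
        ≤ ⟪R y, y⟫_ℝ * (‖finsuppSq m φ‖ ^ 2 + G.form q φ φ) := by
  obtain ⟨a, ha, hcl⟩ := exists_gradient hG hq hm
  have hinj := formInclusion_injective a hcl
  have : CompleteSpace (formSpace a m) :=
    (Submodule.isClosed_topologicalClosure _).completeSpace_coe
  obtain ⟨J, R, hJR, hJ, hR, hRx⟩ := exists_inclusion_mul_adjoint (V := formSpace a m)
    (E := SqSummable X) (formInclusion a m)
  refine ⟨R, hR, fun x => ?_, fun e g => ?_, fun K t h x hx => ?_, fun y φ => ?_⟩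
  · rw [hRx]; positivity
  · rw [mem_operator_iff a ha hm hinj]
    constructor
    · rintro ⟨v, rfl, h⟩
      have : J (formInclusion a m v + g) = v := ext_inner_right ℝ fun w => by rw [hJ, h]
      rw [← hJR, this]
    · intro h
      exact ⟨J (e + g), (hJR _).trans h, fun w => hJ _ w⟩
  · have h1 := mul_norm_sq_formInclusion_le a ha hm h (J x) fun k hk => by rw [hJR, hx k hk]
    rw [hJR, ← hRx] at h1
    have h2 : ⟪R x, x⟫_ℝ ≤ ‖R x‖ * ‖x‖ := real_inner_le_norm _ _
    have h0 : 0 ≤ ⟪R x, x⟫_ℝ := by rw [hRx]; positivity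
    -- For `1 + t > 0`, combine `⟪R x, x⟫² ≤ ‖R x‖² ‖x‖²` with `(1+t) ‖R x‖² ≤ ⟪R x, x⟫` and cancel
    -- one factor.
    rcases le_or_gt (1 + t) 0 with ht | ht
    · nlinarith [sq_nonneg ‖x‖]
    rcases h0.eq_or_lt with h3 | h3
    · rw [← h3]; simp
    have h4 : ⟪R x, x⟫_ℝ ^ 2 ≤ (‖R x‖ * ‖x‖) ^ 2 := by gcongr
    have h5 : (1 + t) * ⟪R x, x⟫_ℝ * ⟪R x, x⟫_ℝ ≤ ‖x‖ ^ 2 * ⟪R x, x⟫_ℝ := by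
      calc (1 + t) * ⟪R x, x⟫_ℝ * ⟪R x, x⟫_ℝ = (1 + t) * ⟪R x, x⟫_ℝ ^ 2 := by ring
        _ ≤ (1 + t) * (‖R x‖ * ‖x‖) ^ 2 := by gcongr
        _ = ((1 + t) * ‖R x‖ ^ 2) * ‖x‖ ^ 2 := by ring
        _ ≤ ⟪R x, x⟫_ℝ * ‖x‖ ^ 2 := by gcongr
        _ = _ := by ring
    exact le_of_mul_le_mul_right h5 h3
  -- Cauchy-Schwarz in the form space, between `J y` and the image of `φ`.
  · set Tφ : formSpace a m := ⟨graphEmbedding a m φ, graphEmbedding_mem a φ⟩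
    have h1 : ⟪y, finsuppSq m φ⟫_ℝ = ⟪J y, Tφ⟫_ℝ := by
      rw [hJ]; rfl
    have h2 : ‖finsuppSq m φ‖ ^ 2 + G.form q φ φ = ‖Tφ‖ ^ 2 :=
      (norm_sq_graphEmbedding a ha φ).symm
    rw [h1, h2, hRx, ← mul_pow, ← sq_abs]
    gcongr
    exact abs_real_inner_le_norm _ _

end SummableGraph

/-! ### Translating spectra between the operator and its resolvent -/

section SpectralTranslation

open scoped InnerProductSpace

variable {X : Type*} {m : X → ℝ} (hm : ∀ x, 0 < m x) {A : Set ((X → ℝ) × (X → ℝ))}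
  (hA : ∀ f g, (f, g) ∈ A → MemL2 m f ∧ MemL2 m g) {R : SqSummable X →L[ℝ] SqSummable X}
  (hRA : ∀ e g, (ofSq m e, ofSq m g) ∈ A ↔ R (e + g) = e)
  (hR : ∀ x y, ⟪R x, y⟫_ℝ = ⟪x, R y⟫_ℝ) (hR0 : ∀ x, 0 ≤ ⟪R x, x⟫_ℝ)

include hm hA hRA in
-- Applying `R` turns `(A - t) e = k` into `(1 - (1+t) R) e = R k`. A solution `e` for `k = y`
-- yields the preimage `y + (1+t) e` of `y`.
theorem mem_resolventSetL2_iff (t : ℝ) :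
    t ∈ resolventSetL2 m A ↔ IsUnit (1 - (1 + t) • R : SqSummable X →L[ℝ] SqSummable X) := by
  set T : SqSummable X →L[ℝ] SqSummable X := 1 - (1 + t) • R with hT
  have hTx : ∀ x, T x = x - (1 + t) • R x := fun x => by simp [hT]
  have hsol : ∀ e k, (ofSq m e, ofSq m k + t • ofSq m e) ∈ A ↔ T e = R k := by
    intro e k
    rw [← map_smul, ← map_add, hRA, hTx, ← add_assoc, add_right_comm, map_add, map_add, map_smul,
      sub_eq_iff_eq_add, add_smul, one_smul, eq_comm, add_comm (R k), add_assoc]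
  constructor
  · rintro ⟨h, -⟩
    refine isUnit_of_bijective ⟨(injective_iff_map_eq_zero T).2 fun e he => ?_, fun y => ?_⟩
    · obtain ⟨f, -, hf⟩ := h (ofSq m 0) (memL2_ofSq hm 0)
      have h1 := hf (ofSq m e) ((hsol e 0).2 (by rw [he, map_zero]))
      have h2 := hf (ofSq m 0) ((hsol 0 0).2 (by rw [map_zero, map_zero]))
      exact ofSq_injective hm (h1.trans h2.symm)
    · obtain ⟨f, hf, -⟩ := h (ofSq m y) (memL2_ofSq hm y)
      obtain ⟨e, rfl⟩ := exists_ofSq_eq hm (hA _ _ hf).1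
      have h1 := (hsol e y).1 hf
      refine ⟨y + (1 + t) • e, ?_⟩
      rw [map_add, map_smul, h1, hTx]
      abel
  · intro hu
    have hbij := bijective_of_isUnit hu
    obtain ⟨c, hc, hcx⟩ := exists_bounded_below_of_isUnit hu
    refine ⟨fun k hk => ?_, ‖R‖ / c, fun f g hfg => ?_⟩
    · obtain ⟨k, rfl⟩ := exists_ofSq_eq hm hk
      obtain ⟨e, he⟩ := hbij.2 (R k)
      refine ⟨ofSq m e, (hsol e k).2 he, fun f hf => ?_⟩
      obtain ⟨e', rfl⟩ := exists_ofSq_eq hm (hA _ _ hf).1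
      rw [hbij.1 (((hsol e' k).1 hf).trans he.symm)]
    · obtain ⟨e, rfl⟩ := exists_ofSq_eq hm (hA _ _ hfg).1
      obtain ⟨g, rfl⟩ := exists_ofSq_eq hm (hA _ _ hfg).2
      have h1 : T e = R (g - t • e) := (hsol e _).1 (by simpa using hfg)
      rw [← map_smul, ← map_sub, l2Norm_ofSq hm, l2Norm_ofSq hm, div_mul_eq_mul_div,
        le_div_iff₀ hc, mul_comm]
      exact (hcx e).trans (h1 ▸ R.le_opNorm _)

include hm hA hRA in
theorem mem_spectrumL2_iff {s : ℝ} (hs : 0 < s) :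
    s⁻¹ - 1 ∈ spectrumL2 m A ↔ s ∈ spectrum ℝ R := by
  rw [spectrumL2, Set.mem_compl_iff, mem_resolventSetL2_iff hm hA hRA, spectrum.mem_iff, not_iff_not,
    add_sub_cancel]
  have h1 : (1 - s⁻¹ • R : SqSummable X →L[ℝ] SqSummable X)
      = (Units.mk0 s⁻¹ (inv_ne_zero hs.ne')) • (algebraMap ℝ (SqSummable X →L[ℝ] SqSummable X) s - R) := by
    rw [Units.smul_mk0, smul_sub, Algebra.algebraMap_eq_smul_one, smul_smul,
      inv_mul_cancel₀ hs.ne', one_smul]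
  rw [h1, isUnit_smul_iff]

include hm hA hRA hR hR0 in
theorem one_add_pos_of_mem_spectrumL2 {t : ℝ} (ht : t ∈ spectrumL2 m A) : 0 < 1 + t := by
  by_contra hneg
  refine ht ((mem_resolventSetL2_iff hm hA hRA t).2 ?_)
  have hTx : ∀ x, (1 - (1 + t) • R : SqSummable X →L[ℝ] SqSummable X) x = x - (1 + t) • R x :=
    fun x => by simp
  have hcoer : ∀ x, ‖x‖ ^ 2
      ≤ ⟪(1 - (1 + t) • R : SqSummable X →L[ℝ] SqSummable X) x, x⟫_ℝ := fun x => by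
    rw [hTx, inner_sub_left, real_inner_smul_left, real_inner_self_eq_norm_sq]
    nlinarith [hR0 x]
  refine isUnit_of_coercive_of_ker_eq_bot _ (fun x y => ?_) ⊥ one_pos
    (fun x _ => by rw [one_mul]; exact hcoer x) fun x hx => ?_
  · simp only [hTx, inner_sub_left, inner_sub_right, real_inner_smul_left, real_inner_smul_right,
      hR]
  · have h1 := hcoer x
    rw [hx, inner_zero_left] at h1
    exact norm_eq_zero.1 (by nlinarith [norm_nonneg x])

include hm hA hRA hR hR0 in
theorem inv_one_add_mem_spectrum {t : ℝ} (ht : t ∈ spectrumL2 m A) :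
    (1 + t)⁻¹ ∈ spectrum ℝ R := by
  have h1 := one_add_pos_of_mem_spectrumL2 hm hA hRA hR hR0 ht
  rw [← mem_spectrumL2_iff hm hA hRA (inv_pos.2 h1), inv_inv, add_sub_cancel_left]
  exact ht

include hRA in
theorem ofSq_mem_eigenspaceL2_iff {t : ℝ} (ht : 0 < 1 + t) (e : SqSummable X) :
    ofSq m e ∈ eigenspaceL2 A t ↔ R e = (1 + t)⁻¹ • e := by
  change (ofSq m e, t • ofSq m e) ∈ A ↔ _
  rw [← map_smul, hRA, ← one_smul ℝ (e + t • e), smul_add, one_smul ℝ (t • e), ← add_smul, map_smul,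
    eq_inv_smul_iff₀ ht.ne']

include hm hA hRA in
theorem eigenspaceL2_eq {t : ℝ} (ht : 0 < 1 + t) :
    eigenspaceL2 A t = (((LinearMap.ker ((R - algebraMap ℝ (SqSummable X →L[ℝ] SqSummable X)
      (1 + t)⁻¹ : SqSummable X →L[ℝ] SqSummable X) : SqSummable X →ₗ[ℝ] SqSummable X)).map
      (ofSq m) : Submodule ℝ (X → ℝ)) : Set (X → ℝ)) := by
  have hker : ∀ e, e ∈ LinearMap.ker ((R - algebraMap ℝ (SqSummable X →L[ℝ] SqSummable X)
      (1 + t)⁻¹ : SqSummable X →L[ℝ] SqSummable X) : SqSummable X →ₗ[ℝ] SqSummable X) ↔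
      R e = (1 + t)⁻¹ • e := fun e => by
    rw [LinearMap.mem_ker, ← sub_eq_zero (a := R e)]
    simp [Algebra.algebraMap_eq_smul_one]
  ext f
  rw [Submodule.map_coe]
  constructor
  · intro hf
    obtain ⟨e, rfl⟩ := exists_ofSq_eq hm (hA _ _ hf).1
    exact ⟨e, (hker e).2 ((ofSq_mem_eigenspaceL2_iff hRA ht e).1 hf), rfl⟩
  · rintro ⟨e, he, rfl⟩
    exact (ofSq_mem_eigenspaceL2_iff hRA ht e).2 ((hker e).1 he)

include hm hA hRA in
theorem isolated_of_mem_discreteSpectrumL2 {s : ℝ} (hs : 0 < s)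
    (h : s⁻¹ - 1 ∈ discreteSpectrumL2 m A) :
    (∃ ε : ℝ, 0 < ε ∧ ∀ t ∈ spectrum ℝ R, |t - s| < ε → t = s) ∧
      FiniteDimensional ℝ (LinearMap.ker ((R - algebraMap ℝ (SqSummable X →L[ℝ] SqSummable X) s :
        SqSummable X →L[ℝ] SqSummable X) : SqSummable X →ₗ[ℝ] SqSummable X)) := by
  obtain ⟨-, ⟨ε, hε, hiso⟩, -, hfin⟩ := h
  constructor
  · obtain ⟨δ, hδ, hcont⟩ := Metric.continuousAt_iff.1 (continuousAt_inv₀ hs.ne') ε hε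
    -- The radius `s` keeps `t` positive, as the inversion `t ↦ t⁻¹ - 1` requires.
    refine ⟨min δ s, lt_min hδ hs, fun t ht hts => ?_⟩
    have ht0 : 0 < t := by
      have := (abs_lt.1 (hts.trans_le (min_le_right _ _))).1
      linarith
    have h1 := hcont (x := t) (hts.trans_le (min_le_left _ _))
    rw [Real.dist_eq] at h1
    have h2 := hiso (t⁻¹ - 1) ((mem_spectrumL2_iff hm hA hRA ht0).2 ht)
      (by rwa [sub_sub_sub_cancel_right])
    exact inv_injective (sub_left_injective h2)
  · have h1 : 0 < 1 + (s⁻¹ - 1) := by rw [add_sub_cancel]; exact inv_pos.2 hs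
    rw [eigenspaceL2_eq hm hA hRA h1, Submodule.span_eq, add_sub_cancel, inv_inv] at hfin
    exact LinearEquiv.finiteDimensional
      (Submodule.equivMapOfInjective (ofSq m) (ofSq_injective hm) _).symm

include hm hA hRA hR hR0 in
theorem exists_eigenvector_of_mem_spectrumL2 (N : Submodule ℝ (SqSummable X))
    [FiniteDimensional ℝ N] {t σ : ℝ} (h : ∀ x ∈ Nᗮ, (1 + t) * ⟪R x, x⟫_ℝ ≤ ‖x‖ ^ 2)
    (hσ : σ ∈ spectrumL2 m A) (hσt : σ < t) : ∃ x, x ≠ 0 ∧ R x = (1 + σ)⁻¹ • x := by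
  by_contra hne
  have h0 := one_add_pos_of_mem_spectrumL2 hm hA hRA hR hR0 hσ
  have h1 := inv_one_add_mem_spectrum hm hA hRA hR hR0 hσ
  rw [spectrum.mem_iff, ← neg_sub, IsUnit.neg_iff] at h1
  refine h1 (isUnit_sub_of_gt R hR N (r := (1 + t)⁻¹) (fun x hx => ?_) ?_ fun x hx => ?_)
  · rw [le_inv_mul_iff₀ (by linarith)]
    exact h x hx
  · exact inv_strictAnti₀ h0 (by linarith)
  · by_contra hx0
    exact hne ⟨x, hx0, hx⟩

include hm hA hRA hR hR0 in
-- Spectral values below `t` come from eigenvalues of `R` above `1/(1+t)`; these are finite in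
-- number, which gives isolation, and have finite multiplicity.
theorem mem_discreteSpectrumL2 (N : Submodule ℝ (SqSummable X)) [FiniteDimensional ℝ N] {t σ : ℝ}
    (h : ∀ x ∈ Nᗮ, (1 + t) * ⟪R x, x⟫_ℝ ≤ ‖x‖ ^ 2) (hσ : σ ∈ spectrumL2 m A) (hσt : σ < t) :
    σ ∈ discreteSpectrumL2 m A := by
  have h0 := one_add_pos_of_mem_spectrumL2 hm hA hRA hR hR0 hσ
  have ht : 0 < 1 + t := by linarith
  have hr : ∀ x ∈ Nᗮ, ⟪R x, x⟫_ℝ ≤ (1 + t)⁻¹ * ‖x‖ ^ 2 := fun x hx => by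
    rw [le_inv_mul_iff₀ ht]; exact h x hx
  refine ⟨hσ, ?_, ?_, ?_⟩
  · have hfin : (spectrumL2 m A ∩ Set.Iio t).Finite := by
      refine Set.Finite.of_finite_image (f := fun σ => (1 + σ)⁻¹)
        ((finite_eigenvalues_gt R hR N hr).subset ?_) ?_
      · rintro _ ⟨τ, ⟨hτ, hτt⟩, rfl⟩
        have h1 := one_add_pos_of_mem_spectrumL2 hm hA hRA hR hR0 hτ
        exact ⟨inv_strictAnti₀ h1 (by linarith [Set.mem_Iio.1 hτt]),
          exists_eigenvector_of_mem_spectrumL2 hm hA hRA hR hR0 N h hτ hτt⟩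
      · intro a _ b _ hab
        exact add_left_cancel (inv_injective hab)
    have hopen : IsOpen (Set.Iio t ∩ ((spectrumL2 m A ∩ Set.Iio t) \ {σ})ᶜ) :=
      isOpen_Iio.inter (hfin.subset Set.sdiff_subset).isClosed.isOpen_compl
    obtain ⟨ε, hε, hball⟩ := Metric.isOpen_iff.1 hopen σ ⟨hσt, by simp⟩
    refine ⟨ε, hε, fun τ hτ hτσ => ?_⟩
    obtain ⟨h2, h3⟩ := hball (show τ ∈ Metric.ball σ ε by rwa [Metric.mem_ball, Real.dist_eq])
    by_contra hne
    exact h3 ⟨⟨hτ, h2⟩, hne⟩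
  · obtain ⟨x, hx0, hx⟩ := exists_eigenvector_of_mem_spectrumL2 hm hA hRA hR hR0 N h hσ hσt
    refine ⟨ofSq m x, (ofSq_mem_eigenspaceL2_iff hRA h0 x).2 hx, fun hzero => hx0 ?_⟩
    exact ofSq_injective hm (hzero.trans (map_zero _).symm)
  · rw [eigenspaceL2_eq hm hA hRA h0, Submodule.span_eq]
    have := finiteDimensional_ker_of_le R N hr (inv_strictAnti₀ h0 (by linarith : 1 + σ < 1 + t))
    infer_instance

end SpectralTranslation

/-! ### Finite rank projections are almost supported on finite sets -/

section Truncation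

open scoped InnerProductSpace

variable {X : Type*}

/-- Truncate `e` to a finite set with small remainder. The factor `2` and the budget `ε / 2` come
from `(a + b)² ≤ 2 a² + 2 b²`. -/
theorem exists_finset_inner_sq_le (e : SqSummable X) {ε : ℝ} (hε : 0 < ε) :
    ∃ (K : Finset X) (C : ℝ), 0 ≤ C ∧
      ∀ x : SqSummable X, ⟪e, x⟫_ℝ ^ 2 ≤ C * ∑ k ∈ K, x k ^ 2 + ε * ‖x‖ ^ 2 := by
  classical
  have h1 := lp.hasSum_single (E := fun _ : X => ℝ) (p := 2) (by norm_num) e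
  have h2 : 0 < √(ε / 2) := Real.sqrt_pos.2 (by linarith)
  obtain ⟨K, hK⟩ := (h1.eventually (Metric.ball_mem_nhds e h2)).exists
  replace hK : ‖e - ∑ k ∈ K, lp.single 2 k (e k)‖ < √(ε / 2) := by
    rw [← dist_eq_norm, dist_comm]; exact hK
  set f : SqSummable X := ∑ k ∈ K, lp.single 2 k (e k)
  have hf : ∀ x : SqSummable X, ⟪f, x⟫_ℝ = ∑ k ∈ K, e k * x k := fun x => by
    rw [sum_inner]
    refine Finset.sum_congr rfl fun k _ => ?_
    rw [lp.inner_single_left]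
    simp [mul_comm]
  refine ⟨K, 2 * ∑ k ∈ K, e k ^ 2, by positivity, fun x => ?_⟩
  have h3 : ⟪e, x⟫_ℝ = ⟪f, x⟫_ℝ + ⟪e - f, x⟫_ℝ := by rw [← inner_add_left, add_sub_cancel]
  have h4 : ⟪e - f, x⟫_ℝ ^ 2 ≤ ε / 2 * ‖x‖ ^ 2 := by
    have h5 : ⟪e - f, x⟫_ℝ ^ 2 ≤ (‖e - f‖ * ‖x‖) ^ 2 := by
      rw [← sq_abs]; gcongr; exact abs_real_inner_le_norm _ _
    have h6 : ‖e - f‖ ^ 2 ≤ ε / 2 := by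
      rw [← Real.sq_sqrt (by linarith : 0 ≤ ε / 2)]
      gcongr
    rw [mul_pow] at h5
    exact h5.trans (by gcongr)
  have h5 : ⟪f, x⟫_ℝ ^ 2 ≤ (∑ k ∈ K, e k ^ 2) * ∑ k ∈ K, x k ^ 2 := by
    rw [hf]; exact Finset.sum_mul_sq_le_sq_mul_sq _ _ _
  rw [h3]
  nlinarith [sq_nonneg (⟪f, x⟫_ℝ - ⟪e - f, x⟫_ℝ)]

theorem exists_finset_projection_sq_le (N : Submodule ℝ (SqSummable X)) [FiniteDimensional ℝ N]
    {ε : ℝ} (hε : 0 < ε) : ∃ (K : Finset X) (C : ℝ), 0 ≤ C ∧ ∀ x : SqSummable X,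
      ‖N.orthogonalProjectionOnto x‖ ^ 2 ≤ C * ∑ k ∈ K, x k ^ 2 + ε * ‖x‖ ^ 2 := by
  classical
  set n := Module.finrank ℝ N
  let b := stdOrthonormalBasis ℝ N
  -- The denominator `n + 1` also covers `N = ⊥`.
  have hε' : 0 < ε / (n + 1) := by positivity
  choose K C hC hKC using fun i => exists_finset_inner_sq_le (b i : SqSummable X) hε'
  refine ⟨Finset.univ.biUnion K, ∑ i, C i, Finset.sum_nonneg fun i _ => hC i, fun x => ?_⟩
  have h1 : ‖N.orthogonalProjectionOnto x‖ ^ 2 = ∑ i, ⟪(b i : SqSummable X), x⟫_ℝ ^ 2 := by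
    rw [← b.sum_sq_norm_inner_right]
    refine Finset.sum_congr rfl fun i _ => ?_
    rw [Real.norm_eq_abs, sq_abs, Submodule.inner_orthogonalProjectionOnto_eq_of_mem_left]
  rw [h1, Finset.sum_mul]
  calc ∑ i, ⟪(b i : SqSummable X), x⟫_ℝ ^ 2
      ≤ ∑ i, (C i * ∑ k ∈ Finset.univ.biUnion K, x k ^ 2 + ε / (n + 1) * ‖x‖ ^ 2) := by
        refine Finset.sum_le_sum fun i _ => (hKC i x).trans ?_
        have h2 : ∑ k ∈ K i, x k ^ 2 ≤ ∑ k ∈ Finset.univ.biUnion K, x k ^ 2 :=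
          Finset.sum_le_sum_of_subset_of_nonneg
            (Finset.subset_biUnion_of_mem K (Finset.mem_univ i)) fun _ _ _ => sq_nonneg _
        have := mul_le_mul_of_nonneg_left h2 (hC i)
        linarith
    _ ≤ _ := by
        rw [Finset.sum_add_distrib, Finset.sum_const, Finset.card_univ, Fintype.card_fin,
          nsmul_eq_mul, ← mul_assoc]
        gcongr
        rw [mul_div_assoc', div_le_iff₀ (by positivity)]
        nlinarith

end Truncation

/-! ### Positive levels and the bottoms of the spectra -/

namespace SummableGraph

open scoped InnerProductSpace

variable {X : Type*} {G : SummableGraph X} {q m : X → ℝ}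

theorem mem_positiveLevels_iff [Nonempty X] (hG : G.Connected) (t : ℝ) :
    t ∈ G.positiveLevels q m ↔ ∀ φ : X →₀ ℝ, 0 ≤ G.form (q - t • m) φ φ := by
  constructor
  · rintro ⟨u, hu, hne⟩ φ
    refine form_nonneg_of_superharmonic (K := ∅) (by simpa using hu)
      (fun x _ => pos_of_superharmonic hG hu hne x) φ (by simp)
  · intro h
    obtain ⟨o⟩ := ‹Nonempty X›
    obtain ⟨u, hu, huo⟩ := exists_superharmonic hG h o
    exact ⟨u, hu, fun h0 => by simp [h0] at huo⟩

theorem positiveLevels_subset_positiveLevelsAtInfinity (hG : G.Connected) :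
    G.positiveLevels q m ⊆ G.positiveLevelsAtInfinity q m := by
  rintro t ⟨u, hu, hne⟩
  exact ⟨∅, u, by simpa using hu, fun x _ => pos_of_superharmonic hG hu hne x⟩

theorem memL2_of_mem_operator (f g : X → ℝ) (h : (f, g) ∈ G.operator q m) :
    MemL2 m f ∧ MemL2 m g := ⟨h.1.1, h.2.1⟩

/-- The levels form an intersection of closed half-lines indexed by test functions; it contains `0`
and is bounded by the Rayleigh quotient of a point mass. -/
theorem isGreatest_csSup_positiveLevels [Nonempty X] (hG : G.Connected)
    (hq : ∀ φ : X →₀ ℝ, 0 ≤ G.form q φ φ) (hm : ∀ x, 0 < m x) :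
    IsGreatest (G.positiveLevels q m) (sSup (G.positiveLevels q m)) := by
  have hmem : ∀ t, t ∈ G.positiveLevels q m ↔
      ∀ φ : X →₀ ℝ, t * ‖finsuppSq m φ‖ ^ 2 ≤ G.form q φ φ := fun t => by
    rw [mem_positiveLevels_iff hG]
    simp only [form_sub_smul q hm, sub_nonneg]
  have h0 : (0 : ℝ) ∈ G.positiveLevels q m := (hmem 0).2 fun φ => by simpa using hq φ
  have hbdd : BddAbove (G.positiveLevels q m) := by
    obtain ⟨o⟩ := ‹Nonempty X›
    have h1 : 0 < ‖finsuppSq m (Finsupp.single o 1)‖ ^ 2 := by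
      rw [norm_sq_finsuppSq hm _ {o} fun x hx => by
        classical
        rw [Finsupp.single_apply, if_neg]; rintro rfl; simp at hx]
      simpa using hm o
    exact ⟨G.form q (Finsupp.single o 1) (Finsupp.single o 1) /
      ‖finsuppSq m (Finsupp.single o 1)‖ ^ 2, fun t ht => (le_div_iff₀ h1).2 ((hmem t).1 ht _)⟩
  have hclosed : IsClosed (G.positiveLevels q m) := by
    have : G.positiveLevels q m
        = ⋂ φ : X →₀ ℝ, {t : ℝ | t * ‖finsuppSq m φ‖ ^ 2 ≤ G.form q φ φ} := by
      ext t; rw [hmem]; simp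
    rw [this]
    exact isClosed_iInter fun φ => isClosed_le (by fun_prop) continuous_const
  exact ⟨hclosed.csSup_mem ⟨0, h0⟩ hbdd, fun t ht => le_csSup hbdd ht⟩

/-- Positive levels are lower bounds of the spectrum. -/
theorem positiveLevel_le_of_mem_spectrum [Nonempty X] (hG : G.Connected)
    (hq : ∀ φ : X →₀ ℝ, 0 ≤ G.form q φ φ) (hm : ∀ x, 0 < m x) {t σ : ℝ}
    (ht : t ∈ G.positiveLevels q m) (hσ : σ ∈ spectrumL2 m (G.operator q m)) : t ≤ σ := by
  obtain ⟨R, hR, hR0, hRA, hK, -⟩ := exists_resolvent hG hq hm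
  by_contra hlt
  have h1 := hK ∅ t (fun φ _ => (mem_positiveLevels_iff hG t).1 ht φ)
  obtain ⟨x, hx0, hx⟩ := exists_eigenvector_of_mem_spectrumL2 hm memL2_of_mem_operator hRA hR hR0 ⊥
    (fun x _ => h1 x (by simp)) hσ (not_le.1 hlt)
  have h2 := one_add_pos_of_mem_spectrumL2 hm memL2_of_mem_operator hRA hR hR0 hσ
  have h3 := h1 x (by simp)
  have h4 : 0 < ‖x‖ ^ 2 := by have := norm_pos_iff.2 hx0; positivity
  rw [hx, real_inner_smul_left, real_inner_self_eq_norm_sq, ← mul_assoc, ← div_eq_mul_inv] at h3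
  have h5 : 1 < (1 + t) / (1 + σ) := (one_lt_div h2).2 (by linarith)
  nlinarith

/-- If the spectrum in `(-∞, t]` is discrete, the form is bounded below by `t` up to a finite
dimensional projection. -/
theorem exists_projection_le_form [Nonempty X] (hG : G.Connected)
    (hq : ∀ φ : X →₀ ℝ, 0 ≤ G.form q φ φ) (hm : ∀ x, 0 < m x) {t : ℝ} (ht : 0 < 1 + t)
    (h : ∀ σ ∈ spectrumL2 m (G.operator q m), σ ≤ t → σ ∈ discreteSpectrumL2 m (G.operator q m)) :
    ∃ N : Submodule ℝ (SqSummable X), FiniteDimensional ℝ N ∧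
      ((∀ σ ∈ spectrumL2 m (G.operator q m), t < σ) → N = ⊥) ∧
      ∀ φ : X →₀ ℝ, ∀ y ∈ Nᗮ,
        (1 + t) * ⟪y, finsuppSq m φ⟫_ℝ ^ 2 ≤ ‖y‖ ^ 2 * (‖finsuppSq m φ‖ ^ 2 + G.form q φ φ) := by
  obtain ⟨R, hR, hR0, hRA, -, hform⟩ := exists_resolvent hG hq hm
  set r := (1 + t)⁻¹ with hr
  have hr0 : 0 < r := inv_pos.2 ht
  have hle : ∀ s, r ≤ s → s⁻¹ - 1 ≤ t := fun s hs => by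
    have := inv_anti₀ hr0 hs
    rw [hr, inv_inv] at this
    linarith
  have hspec : ∀ s ∈ spectrum ℝ R, r ≤ s → s⁻¹ - 1 ∈ spectrumL2 m (G.operator q m) :=
    fun s hs hrs => (mem_spectrumL2_iff hm memL2_of_mem_operator hRA (hr0.trans_le hrs)).2 hs
  have hdisc := fun s (hs : s ∈ spectrum ℝ R) (hrs : r ≤ s) =>
    isolated_of_mem_discreteSpectrumL2 hm memL2_of_mem_operator hRA (hr0.trans_le hrs)
      (h _ (hspec s hs hrs) (hle s hrs))
  have hfin : Finite ↑(spectrum ℝ R ∩ Set.Ici r) :=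
    finite_spectrum_inter_of_isolated R fun s hs hrs => (hdisc s hs hrs).1
  have hfd : ∀ s : ↑(spectrum ℝ R ∩ Set.Ici r), FiniteDimensional ℝ (LinearMap.ker
      ((R - algebraMap ℝ (SqSummable X →L[ℝ] SqSummable X) s : SqSummable X →L[ℝ] SqSummable X) :
        SqSummable X →ₗ[ℝ] SqSummable X)) := fun s => (hdisc s s.2.1 s.2.2).2
  -- `N` is the sum of the eigenspaces of `R` for its finitely many spectral values at least `r`.
  refine ⟨⨆ s : ↑(spectrum ℝ R ∩ Set.Ici r), LinearMap.ker
      ((R - algebraMap ℝ (SqSummable X →L[ℝ] SqSummable X) s : SqSummable X →L[ℝ] SqSummable X) :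
        SqSummable X →ₗ[ℝ] SqSummable X), Submodule.finiteDimensional_iSup _, fun hgt => ?_,
      fun φ y hy => ?_⟩
  · have : IsEmpty ↑(spectrum ℝ R ∩ Set.Ici r) :=
      ⟨fun s => (hgt _ (hspec s s.2.1 s.2.2)).not_ge (hle s s.2.2)⟩
    exact iSup_of_empty _
  · have h1 : ⟪R y, y⟫_ℝ ≤ r * ‖y‖ ^ 2 := by
      refine inner_le_of_isolated R hR (fun s hs hrs => (hdisc s hs hrs).1) fun s hs hrs z hz => ?_
      refine (Submodule.mem_orthogonal _ _).1 hy z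
        (Submodule.mem_iSup_of_mem ⟨s, hs, hrs⟩ (LinearMap.mem_ker.2 ?_))
      simp [Algebra.algebraMap_eq_smul_one, hz]
    have h2 := hform y φ
    have h3 : 0 ≤ ‖finsuppSq m φ‖ ^ 2 + G.form q φ φ := add_nonneg (sq_nonneg _) (hq φ)
    calc (1 + t) * ⟪y, finsuppSq m φ⟫_ℝ ^ 2
        ≤ (1 + t) * (r * ‖y‖ ^ 2 * (‖finsuppSq m φ‖ ^ 2 + G.form q φ φ)) := by
          gcongr
          exact h2.trans (by gcongr)
      _ = _ := by rw [hr]; field_simp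

theorem mem_positiveLevels_of_lt_spectrum [Nonempty X] (hG : G.Connected)
    (hq : ∀ φ : X →₀ ℝ, 0 ≤ G.form q φ φ) (hm : ∀ x, 0 < m x) {t : ℝ} (ht : 0 < 1 + t)
    (h : ∀ σ ∈ spectrumL2 m (G.operator q m), t < σ) : t ∈ G.positiveLevels q m := by
  obtain ⟨N, -, hN, hform⟩ := exists_projection_le_form hG hq hm ht
    fun σ hσ hσt => absurd (h σ hσ) (not_lt.2 hσt)
  obtain rfl := hN h
  rw [mem_positiveLevels_iff hG]
  intro φ
  rw [form_sub_smul q hm]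
  have h1 := hform φ (finsuppSq m φ) (by simp)
  rw [real_inner_self_eq_norm_sq] at h1
  rcases (sq_nonneg ‖finsuppSq m φ‖).eq_or_lt with h2 | h2
  · rw [← h2]; simpa using hq φ
  · have h3 : ((1 + t) * ‖finsuppSq m φ‖ ^ 2) * ‖finsuppSq m φ‖ ^ 2
        ≤ (‖finsuppSq m φ‖ ^ 2 + G.form q φ φ) * ‖finsuppSq m φ‖ ^ 2 := by linarith
    have h4 := le_of_mul_le_mul_right h3 h2
    linarith

theorem mem_positiveLevelsAtInfinity_of_discrete [Nonempty X] (hG : G.Connected)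
    (hq : ∀ φ : X →₀ ℝ, 0 ≤ G.form q φ φ) (hm : ∀ x, 0 < m x) {c t : ℝ} (ht : 0 < 1 + t)
    (hct : c < t)
    (h : ∀ σ ∈ spectrumL2 m (G.operator q m), σ ≤ t → σ ∈ discreteSpectrumL2 m (G.operator q m)) :
    c ∈ G.positiveLevelsAtInfinity q m := by
  classical
  obtain ⟨N, hN, -, hform⟩ := exists_projection_le_form hG hq hm ht h
  -- This `ε` satisfies `(1+t) ε = t - c`: the error uses exactly the gap between `t` and `c`, and
  -- the potential `p` pays for `(1+t) C` on `K`.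
  obtain ⟨K, C, hC, hKC⟩ := exists_finset_projection_sq_le N
    (ε := (t - c) / (1 + t)) (div_pos (sub_pos.2 hct) ht)
  set p : X → ℝ := fun x => if x ∈ K then (1 + t) * C * m x else 0 with hp
  have hnonneg : ∀ φ : X →₀ ℝ, 0 ≤ G.form (q - c • m + p) φ φ := by
    intro φ
    rw [form_add_potential _ p φ (φ.support ∪ K) (by simp +contextual), form_sub_smul q hm]
    have h1 : ∑ x ∈ φ.support ∪ K, p x * φ x ^ 2
        = (1 + t) * C * ∑ k ∈ K, finsuppSq m φ k ^ 2 := by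
      rw [← Finset.sum_subset Finset.subset_union_right fun x _ hx => by simp [hp, hx],
        Finset.mul_sum]
      refine Finset.sum_congr rfl fun x hx => ?_
      simp only [hp, if_pos hx, finsuppSq_apply]
      rw [mul_pow, Real.sq_sqrt (hm x).le]
      ring
    rw [h1]
    set x := finsuppSq m φ
    set P := N.orthogonalProjectionOnto x
    set y := x - (P : SqSummable X) with hy
    have hyN : y ∈ Nᗮ := by
      rw [hy]
      exact N.sub_starProjection_mem_orthogonal x
    have hPy : ⟪y, (P : SqSummable X)⟫_ℝ = 0 := by
      rw [real_inner_comm]; exact (Submodule.mem_orthogonal _ _).1 hyN _ P.2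
    have hxy : ⟪y, x⟫_ℝ = ‖y‖ ^ 2 := by
      rw [← real_inner_self_eq_norm_sq]
      nth_rewrite 3 [hy]
      rw [inner_sub_right, hPy, sub_zero]
    have hpyth : ‖x‖ ^ 2 = ‖y‖ ^ 2 + ‖P‖ ^ 2 := by
      have h2 : x = y + (P : SqSummable X) := by rw [hy, sub_add_cancel]
      rw [h2, norm_add_sq_real, hPy, Submodule.coe_norm]
      ring
    have h2 := hform φ y hyN
    rw [hxy] at h2
    have h3 : (1 + t) * ‖y‖ ^ 2 ≤ ‖x‖ ^ 2 + G.form q φ φ := by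
      rcases (sq_nonneg ‖y‖).eq_or_lt with h4 | h4
      · rw [← h4, mul_zero]; exact add_nonneg (sq_nonneg _) (hq φ)
      · refine le_of_mul_le_mul_right (?_ : _ * ‖y‖ ^ 2 ≤ _ * ‖y‖ ^ 2) h4
        linarith
    have h4 := mul_le_mul_of_nonneg_left (hKC x) ht.le
    have h5 : (1 + t) * (C * ∑ k ∈ K, x k ^ 2 + (t - c) / (1 + t) * ‖x‖ ^ 2)
        = (1 + t) * C * ∑ k ∈ K, x k ^ 2 + (t - c) * ‖x‖ ^ 2 := by
      field_simp
    rw [h5] at h4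
    nlinarith
  obtain ⟨o⟩ := ‹Nonempty X›
  obtain ⟨u, hu, huo⟩ := exists_superharmonic hG hnonneg o
  refine ⟨K, u, ⟨hu.1, hu.2.1, fun x hx => ?_⟩, fun x _ =>
    pos_of_superharmonic hG hu (fun h0 => by simp [h0] at huo) x⟩
  have h1 := hu.2.2 x trivial
  have hpx : p x = 0 := if_neg hx
  simpa [schrodinger, hpx] using h1

/-- Positive levels at infinity are lower bounds of the essential spectrum. -/
theorem mem_discreteSpectrum_of_lt_positiveLevelAtInfinity [Nonempty X] (hG : G.Connected)
    (hq : ∀ φ : X →₀ ℝ, 0 ≤ G.form q φ φ) (hm : ∀ x, 0 < m x) {t σ : ℝ}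
    (ht : t ∈ G.positiveLevelsAtInfinity q m) (hσ : σ ∈ spectrumL2 m (G.operator q m))
    (hσt : σ < t) : σ ∈ discreteSpectrumL2 m (G.operator q m) := by
  obtain ⟨R, hR, hR0, hRA, hK, -⟩ := exists_resolvent hG hq hm
  obtain ⟨K, u, hu, hpos⟩ := ht
  -- By symmetry of `R`, orthogonality to these vectors means that `R x` vanishes on `K`.
  set N : Submodule ℝ (SqSummable X) :=
    Submodule.span ℝ (Set.range fun k : K => R (finsuppSq m (Finsupp.single (k : X) 1)))
  have : FiniteDimensional ℝ N := FiniteDimensional.span_of_finite ℝ (Set.finite_range _)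
  refine mem_discreteSpectrumL2 hm memL2_of_mem_operator hRA hR hR0 N (fun x hx => ?_) hσ hσt
  refine hK K t (fun φ hφ => form_nonneg_of_superharmonic hu (fun x hx => hpos x hx) φ
    fun x hx => hφ x hx) x fun k hk => ?_
  have h1 := (Submodule.mem_orthogonal _ _).1 hx _ (Submodule.subset_span ⟨⟨k, hk⟩, rfl⟩)
  rw [hR, real_inner_comm, inner_finsuppSq _ _ {k} fun x hx => by
    classical
    rw [Finsupp.single_apply, if_neg]; rintro rfl; simp at hx] at h1
  simpa [finsuppSq_apply, (Real.sqrt_pos.2 (hm k)).ne'] using h1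

end SummableGraph

theorem mainTheorem3 {X : Type*} [Infinite X] (G : SummableGraph X) (hG : G.Connected)
    (q : X → ℝ) (hq : ∀ φ : X →₀ ℝ, 0 ≤ G.form q φ φ)
    (m : X → ℝ) (hm : ∀ x, 0 < m x) :
    (sSup ((fun t : ℝ => (t : EReal)) '' G.positiveLevels q m) ≤
        spectrumBottom m (G.operator q m)) ∧
    (opDomain (G.operator q m) ⊆ G.formalDomain →
      IsGreatest ((fun t : ℝ => (t : EReal)) '' G.positiveLevels q m)
        (spectrumBottom m (G.operator q m))) ∧
    ((∀ φ : X →₀ ℝ, MemL2 m fun x => 1 / m x * G.laplacian (⇑φ) x) →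
      essSpectrumBottom m (G.operator q m) =
        sSup ((fun t : ℝ => (t : EReal)) '' G.positiveLevelsAtInfinity q m)) := by
  have hlower : ∀ t ∈ G.positiveLevels q m, (t : EReal) ≤ spectrumBottom m (G.operator q m) := by
    intro t ht
    refine le_sInf ?_
    rintro _ ⟨σ, hσ, rfl⟩
    exact EReal.coe_le_coe_iff.2 (G.positiveLevel_le_of_mem_spectrum hG hq hm ht hσ)
  have h0 : (0 : ℝ) ∈ G.positiveLevels q m :=
    (SummableGraph.mem_positiveLevels_iff hG 0).2 fun φ => by simpa using hq φ
  refine ⟨sSup_le ?_, fun _ => ?_, fun _ => le_antisymm ?_ (sSup_le ?_)⟩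
  · rintro _ ⟨t, ht, rfl⟩
    exact hlower t ht
  · have hmax := SummableGraph.isGreatest_csSup_positiveLevels hG hq hm
    set l := sSup (G.positiveLevels q m)
    have hl : spectrumBottom m (G.operator q m) = l := by
      refine le_antisymm (not_lt.1 fun hlt => ?_) (hlower l hmax.1)
      obtain ⟨t, hlt, ht⟩ := EReal.lt_iff_exists_real_btwn.1 hlt
      have hlt' : l < t := EReal.coe_lt_coe_iff.1 hlt
      have hl0 : 0 ≤ l := hmax.2 h0
      refine hlt'.not_ge (hmax.2 ?_)
      refine SummableGraph.mem_positiveLevels_of_lt_spectrum hG hq hm (by linarith) fun σ hσ => ?_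
      exact EReal.coe_lt_coe_iff.1 (ht.trans_le (sInf_le ⟨σ, hσ, rfl⟩))
    rw [hl]
    refine ⟨⟨l, hmax.1, rfl⟩, ?_⟩
    rintro _ ⟨t, ht, rfl⟩
    exact EReal.coe_le_coe_iff.2 (hmax.2 ht)
  · refine le_of_forall_lt fun a ha => ?_
    obtain ⟨c, hac, hc⟩ := EReal.lt_iff_exists_real_btwn.1 ha
    refine hac.trans_le ?_
    -- Negative `c` lie below the level `0`; for `c ≥ 0` any `t > c` satisfies `0 < 1 + t`.
    rcases lt_or_ge c 0 with hc0 | hc0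
    · exact (EReal.coe_le_coe_iff.2 hc0.le).trans
        (le_sSup ⟨0, SummableGraph.positiveLevels_subset_positiveLevelsAtInfinity hG h0, rfl⟩)
    · obtain ⟨t, hct, ht⟩ := EReal.lt_iff_exists_real_btwn.1 hc
      have hct' : c < t := EReal.coe_lt_coe_iff.1 hct
      refine le_sSup ⟨c, SummableGraph.mem_positiveLevelsAtInfinity_of_discrete hG hq hm
        (by linarith) hct' fun σ hσ hσt => ?_, rfl⟩
      by_contra hd
      have h1 : essSpectrumBottom m (G.operator q m) ≤ (σ : EReal) := sInf_le ⟨σ, ⟨hσ, hd⟩, rfl⟩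
      exact hσt.not_gt (EReal.coe_lt_coe_iff.1 (ht.trans_le h1))
  · rintro _ ⟨t, ht, rfl⟩
    refine le_sInf ?_
    rintro _ ⟨σ, ⟨hσ, hd⟩, rfl⟩
    refine EReal.coe_le_coe_iff.2 (not_lt.1 fun hσt => hd ?_)
    exact SummableGraph.mem_discreteSpectrum_of_lt_positiveLevelAtInfinity hG hq hm ht hσ hσt
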